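/- \textbf{Theorem (Weak convergence).} Let $\Omega\subset\mathbb R^n$ be compact, and let $\mathcal M(\Omega)=C(\Omega)^*$ be the space of signed Radon measures on $\Omega$, with the Radon (total variation) norm $\|\mu\|_{\mathcal M}$ and the pairing $\langle f,\mu\rangle=\int_\Omega f\,d\mu$. Let $0\not\equiv\rho\in C_c(\mathbb R^n)$ be real, symmetric ($\rho(-x)=\rho(x)$), with non-negative Fourier transform. Put $\mathcal D\mu:=\rho*\mu$, i.e. $(\mathcal D\mu)(x)=\int_\Omega\rho(x-y)\,d\mu(y)$ for $x\in\Omega$, and $\|\mu\|_{\mathcal D}:=\sqrt{\langle\mathcal D\mu,\mu\rangle}$. Let $F:\mathcal M(\Omega)\to\mathbb R$ be convex and Fréchet differentiable with derivatives $F'(\mu)\in C(\Omega)$, and suppose that for some $L\in\mathbb R$ $$F(\nu)-F(\mu)-\langle F'(\mu),\nu-\mu\rangle\le\tfrac L2\|\nu-\mu\|_{\mathcal D}^2\qquad(\mu,\nu\in\mathcal M(\Omega)).$$ Let $\alpha>0$ and $G(\mu):=\alpha\|\mu\|_{\mathcal M}$ if $\mu\ge0$, $G(\mu):=\infty$ otherwise.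 Let $\tau>0$ with $\tau L<1$, let $\kappa\in(0,1)$, and let $\epsilon_{k+1}>0$ $(k\in\mathbb N)$. The \emph{measure forward-backward method} ($\mu$FB) starts from a discrete measure $\mu^0$ (a finite real combination of Dirac measures) and, for $k=0,1,2,\dots$, takes with $v_k:=F'(\mu^k)$ as $\mu^{k+1}$ a result of the following \emph{insert-and-adjust} loop, or any other solution $\mu^{k+1}\ge0$ in $\mathcal M(\Omega)$ of the step problem $$\left\{\begin{aligned} &\tau[v_k+\alpha]+\mathcal D(\mu^{k+1}-\mu^k)\ge-\epsilon_{k+1}\ \text{ on }\Omega,\\ &\tau[v_k+\alpha]+\mathcal D(\mu^{k+1}-\mu^k)\le\epsilon_{k+1}\ \text{ on }\operatorname{supp}\mu^{k+1},\\ &\langle\tau[v_k+\alpha]+\mathcal D(\mu^{k+1}-\mu^k),\mu^{k+1}\rangle\le\kappa\epsilon_{k+1}. \end{aligned}\right.$$ The loop, run when $\operatorname{supp}\mu^k$ is finite, starts with $S:=\operatorname{supp}\mu^k$, $\eta:=\tau v_k-\mathcal D\mu^k$ and $\lambda:=\tau\alpha$. It finds weights $\beta\in[0,\infty)^S$ such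 that, for some $w\in\mathbb R^S$ with $w_x\le1$, and $w_x=1$ where $\beta_x>0$, $$\Bigl|\sum_{x\in S}\beta_x\rho(y-x)+\eta(y)+\lambda w_y\Bigr|\le\frac{\kappa\epsilon_{k+1}}{1+\sum_{x\in S}\beta_x}\qquad(y\in S),$$ and sets $\mu:=\sum_{x\in S}\beta_x\delta_x$. It returns $\mu$ if $\mathcal D\mu+\eta+\lambda\ge-\epsilon_{k+1}$ on $\Omega$; otherwise it inserts into $S$ a point of $\Omega$ that violates this bound, and repeats. Let $\{\mu^k\}_{k\in\mathbb N}$ be generated by $\mu$FB, and suppose that \begin{enumerate} \item[(i)] $F'$ is continuous from $(\mathcal M(\Omega),\|\cdot\|_{\mathcal D})$ to $C(\Omega)$ with the supremum norm; \item[(ii)] $\sum_{k=0}^\infty\epsilon_{k+1}<\infty$; \item[(iii)] $[F+G](\mu)\ge\phi(\|\mu\|_{\mathcal M})$ for all $\mu\in\mathcal M(\Omega)$, for some $\phi:[0,\infty)\to(-\infty,\infty]$ that is bounded from below and for which $\lim_{t\to\infty}\phi(t)/t$ exists in $(0,\infty]$. \end{enumerate} Write $\partial[F+G](\mu)=\{w\in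 C(\Omega)\mid[F+G](\mu)+\langle w,\nu-\mu\rangle\le[F+G](\nu)\text{ for all }\nu\in\mathcal M(\Omega)\}$. A weak-$*$ limit point of $\{\mu^k\}$ is the weak-$*$ limit of a subsequence. Then: \begin{enumerate} \item There exists a weak-$*$ limit point $\bar\mu$ of $\{\mu^k\}$ with $0\in\partial[F+G](\bar\mu)$, i.e. one that minimises $F+G$. \item Any two such points $\bar\mu,\hat\mu$ satisfy $\|\bar\mu-\hat\mu\|_{\mathcal D}=0$. \item If a point $\bar\mu$ with both properties is unique, then $\mu^k\rightharpoonup\bar\mu$ weakly-$*$ in $\mathcal M(\Omega)$. \item The point is unique, so that the whole sequence converges weakly-$*$ to it, if $\|\cdot\|_{\mathcal D}$ is a norm on $\mathcal M(\Omega)$; and also if there is a (real-valued) $u\in L^2(\mathbb R^n)\cap C_0(\mathbb R^n)$ with $\rho=u*u$ such that the linear span of $\{x\mapsto u(x-y)\mid y\in\Omega\}$ is dense in $C(\Omega)$. \end{enumerate} -/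

import Mathlib

open MeasureTheory Filter Topology
open scoped FourierTransform

namespace MuFB

noncomputable section

/-- The Euclidean space `ℝⁿ`. -/
abbrev Space (n : ℕ) : Type := EuclideanSpace ℝ (Fin n)

/-- `ℳ(Ω)`: the finite signed Borel measures on `Ω ⊆ ℝⁿ`. (On a compact `Ω ⊆ ℝⁿ` these are exactly
the signed Radon measures.) The real vector space structure and the order are Mathlib's. -/
abbrev Meas {n : ℕ} (Ω : Set (Space n)) : Type := SignedMeasure Ω

variable {n : ℕ} {Ω : Set (Space n)}

/-- The dual product `⟨f, μ⟩ = ∫ f dμ` of a function and a signed measure. -/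
def pairing (f : Ω → ℝ) (μ : Meas Ω) : ℝ := ∫ᵛ x, f x ∂<•μ

/-- The Radon norm `‖μ‖_ℳ = |μ|(Ω)`. -/
def radonNorm (μ : Meas Ω) : ℝ := (VectorMeasure.variation μ).real Set.univ

/-- The support of a measure. -/
def supp (μ : Meas Ω) : Set Ω := (VectorMeasure.variation μ).support

/-- The discrete measure `∑_{x ∈ S} β_x δ_x`. -/
def discrete (S : Finset Ω) (β : Ω → ℝ) : Meas Ω := ∑ x ∈ S, VectorMeasure.dirac x (β x)

/-- Membership in the set `𝒵(Ω)` of discrete measures. -/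
def IsDiscrete (μ : Meas Ω) : Prop := ∃ (S : Finset Ω) (β : Ω → ℝ), μ = discrete S β

/-- Weak-* convergence in `ℳ(Ω) = C(Ω)^*`, for compact `Ω`. -/
def WeakStarTendsto (μ : ℕ → Meas Ω) (ν : Meas Ω) : Prop :=
  ∀ f : C(Ω, ℝ), Tendsto (fun k => pairing f (μ k)) atTop (𝓝 (pairing f ν))

/-- `ν` is a weak-* limit point of the sequence `μ`: some subsequence converges weakly-* to `ν`. -/
def IsWeakStarLimitPoint (μ : ℕ → Meas Ω) (ν : Meas Ω) : Prop :=
  ∃ s : ℕ → ℕ, StrictMono s ∧ WeakStarTendsto (fun j => μ (s j)) ν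

/-! ### The particle-to-wave operator -/

/-- `0 ≢ ρ ∈ C_c(ℝⁿ)` is symmetric with a non-negative Fourier transform. (The Fourier transform of
a symmetric real function is real, so that its real part is the whole of it.) -/
structure IsKernel (ρ : Space n → ℝ) : Prop where
  continuous : Continuous ρ
  hasCompactSupport : HasCompactSupport ρ
  ne_zero : ρ ≠ 0
  symmetric : ∀ x, ρ (-x) = ρ x
  fourier_nonneg : ∀ ξ : Space n, 0 ≤ (𝓕 (fun x : Space n => (ρ x : ℂ)) ξ).re

/-- The particle-to-wave operator `𝒟μ = ρ * μ`, as a function on `Ω`. -/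
def waveOp (ρ : Space n → ℝ) (μ : Meas Ω) (x : Ω) : ℝ :=
  pairing (fun y : Ω => ρ ((x : Space n) - (y : Space n))) μ

/-- The seminorm `‖μ‖_𝒟 = √⟨𝒟μ, μ⟩`. -/
def waveNorm (ρ : Space n → ℝ) (μ : Meas Ω) : ℝ := √(pairing (waveOp ρ μ) μ)

/-- The kernel `ρ` has a convolution square root `u = ρ^{1/2} ∈ L²(ℝⁿ) ∩ C₀(ℝⁿ)`, i.e. `ρ = u * u`,
such that `V_u(Ω) = {x ↦ u(x - y) | y ∈ Ω}` is fundamental for `C(Ω)`. -/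
def HasFundamentalSqrt (Ω : Set (Space n)) [CompactSpace Ω] (ρ : Space n → ℝ) : Prop :=
  ∃ u : Space n → ℝ,
    MemLp u 2 volume ∧ Continuous u ∧ Tendsto u (cocompact (Space n)) (𝓝 0) ∧
    (∀ x, ρ x = ∫ y, u y * u (x - y)) ∧
    Dense (Submodule.span ℝ
      {f : C(Ω, ℝ) | ∃ y : Ω, ∀ x : Ω, f x = u ((x : Space n) - (y : Space n))} : Set C(Ω, ℝ))

/-! ### The objective -/

/-- `F : ℳ(Ω) → ℝ` is pre-differentiable with derivative `F'`: it is Fréchet differentiable in the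
Radon norm at each `μ`, and its derivative is (the pairing with) `F' μ ∈ C(Ω)`. -/
def HasPreDeriv (F : Meas Ω → ℝ) (F' : Meas Ω → C(Ω, ℝ)) : Prop :=
  ∀ μ : Meas Ω, ∀ ε > 0, ∃ δ > 0, ∀ ν : Meas Ω, radonNorm (ν - μ) < δ →
    |F ν - F μ - pairing (F' μ) (ν - μ)| ≤ ε * radonNorm (ν - μ)

/-- `F` is `L`-smooth with respect to `‖·‖_𝒟`. -/
def IsSmooth (ρ : Space n → ℝ) (L : ℝ) (F : Meas Ω → ℝ) (F' : Meas Ω → C(Ω, ℝ)) : Prop :=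
  ∀ μ ν : Meas Ω, F ν - F μ - pairing (F' μ) (ν - μ) ≤ L / 2 * waveNorm ρ (ν - μ) ^ 2

/-- `F'` is continuous from `ℳ(Ω)` with the seminorm `‖·‖_𝒟` to `C(Ω)` with the supremum norm. -/
def WaveContinuous [CompactSpace Ω] (ρ : Space n → ℝ) (F' : Meas Ω → C(Ω, ℝ)) : Prop :=
  ∀ μ : Meas Ω, ∀ ε > 0, ∃ δ > 0, ∀ ν : Meas Ω, waveNorm ρ (ν - μ) < δ → ‖F' ν - F' μ‖ < ε

open scoped Classical in
/-- `G(μ) = α‖μ‖_ℳ + δ_{≥ 0}(μ)`. -/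
def regulariser (α : ℝ) (μ : Meas Ω) : EReal :=
  if 0 ≤ μ then ((α * radonNorm μ : ℝ) : EReal) else ⊤

/-- The objective `F + G`. -/
def objective (F : Meas Ω → ℝ) (α : ℝ) (μ : Meas Ω) : EReal := (F μ : EReal) + regulariser α μ

/-- The pre-subdifferential `∂H(μ) ⊆ C(Ω)` of `H : ℳ(Ω) → (-∞, ∞]`, `H ≢ ∞`. -/
def preSubdifferential (H : Meas Ω → EReal) (μ : Meas Ω) : Set C(Ω, ℝ) :=
  {w | ∀ ν : Meas Ω, H μ + ((pairing w (ν - μ) : ℝ) : EReal) ≤ H ν}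

/-! ### The method -/

/-- The approximate optimality conditions that define one step `μ ↦ μ'` of the method, where
`v = F'(μ)`:
`τ[v + α] + 𝒟(μ' - μ) ≥ -ε` on `Ω`, `τ[v + α] + 𝒟(μ' - μ) ≤ ε` on `supp μ'`, and
`⟨τ[v + α] + 𝒟(μ' - μ), μ'⟩ ≤ κε`, for a measure `μ' ≥ 0`. -/
structure StepProblem (ρ : Space n → ℝ) (α τ κ ε : ℝ) (v : C(Ω, ℝ)) (μ μ' : Meas Ω) : Prop where
  nonneg : 0 ≤ μ'
  lower : ∀ x : Ω, -ε ≤ τ * (v x + α) + waveOp ρ (μ' - μ) x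
  upper : ∀ x ∈ supp μ', τ * (v x + α) + waveOp ρ (μ' - μ) x ≤ ε
  bounded : pairing (fun x => τ * (v x + α) + waveOp ρ (μ' - μ) x) μ' ≤ κ * ε

/-- The weights `β ≥ 0` on the finite set `S` solve the finite-dimensional subproblem
`min_{β ≥ 0} ½⟨β, Dβ⟩ + ⟨η, β⟩ + lam ‖β‖₁`, `D = (ρ(y - x))_{x, y ∈ S}`, to the accuracy
`‖Dβ + η + lam w‖_∞ ≤ κε / (1 + ‖β‖₁)`, where `w` is a subgradient at `β` of the `ℓ¹`-norm
restricted to non-negative weights: `w ≤ 1`, with equality where `β > 0`. -/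
def SolvesSubproblem (ρ : Space n → ℝ) (η : Ω → ℝ) (lam ε κ : ℝ) (S : Finset Ω) (β : Ω → ℝ) :
    Prop :=
  (∀ x ∈ S, 0 ≤ β x) ∧
  ∃ w : Ω → ℝ, (∀ x ∈ S, w x ≤ 1 ∧ (0 < β x → w x = 1)) ∧
    ∀ y ∈ S, |∑ x ∈ S, β x * ρ ((y : Space n) - (x : Space n)) + η y + lam * w y|
      ≤ κ * ε / (1 + ∑ x ∈ S, β x)

open scoped Classical in
/-- `InsertAndAdjust ρ η lam ε κ S μ'`: the point insertion and weight adjustment loop, started with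
the finite set `S` of points, can return the measure `μ'`. In each pass weights `β` on `S` are found
by solving the finite-dimensional subproblem. The loop returns `∑_{x ∈ S} β_x δ_x =: μ` if
`𝒟μ + η + lam ≥ -ε` on `Ω`, and otherwise inserts into `S` a point (such as a minimiser of
`𝒟μ + η + lam`) that violates this bound. -/
inductive InsertAndAdjust (ρ : Space n → ℝ) (η : Ω → ℝ) (lam ε κ : ℝ) :
    Finset Ω → Meas Ω → Prop
  | finish (S : Finset Ω) (β : Ω → ℝ) (hβ : SolvesSubproblem ρ η lam ε κ S β)
      (hbound : ∀ y : Ω, -ε ≤ waveOp ρ (discrete S β) y + η y + lam) :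
      InsertAndAdjust ρ η lam ε κ S (discrete S β)
  | insert (S : Finset Ω) (β : Ω → ℝ) (x : Ω) (μ' : Meas Ω)
      (hβ : SolvesSubproblem ρ η lam ε κ S β)
      (hviolated : waveOp ρ (discrete S β) x + η x + lam < -ε)
      (hcontinue : InsertAndAdjust ρ η lam ε κ (insert x S) μ') :
      InsertAndAdjust ρ η lam ε κ S μ'

/-- One step `μ ↦ μ'` of the forward-backward method with tolerance `ε`, where `v = F'(μ)`. Either
`μ'` is a result of point insertion and weight adjustment started from `supp μ` (with
`η = τv - 𝒟μ` and `lam = τα`), or it is any other solution of the step problem (which also allows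
for heuristics, such as spike merging, that maintain the step problem). -/
inductive Step (ρ : Space n → ℝ) (α τ κ ε : ℝ) (v : C(Ω, ℝ)) (μ μ' : Meas Ω) : Prop
  | insertAndAdjust (S : Finset Ω) (hS : (S : Set Ω) = supp μ)
      (h : InsertAndAdjust ρ (fun x => τ * v x - waveOp ρ μ x) (τ * α) ε κ S μ')
  | other (h : StepProblem ρ α τ κ ε v μ μ')

/-- The sequence `μ⁰, μ¹, …` is generated by the measure forward-backward method (μFB) with the
tolerances `ε₁, ε₂, …` from a discrete initial iterate. -/
structure IsGenerated (ρ : Space n → ℝ) (F' : Meas Ω → C(Ω, ℝ)) (α τ κ : ℝ) (ε : ℕ → ℝ)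
    (μ : ℕ → Meas Ω) : Prop where
  initial : IsDiscrete (μ 0)
  step : ∀ k, Step ρ α τ κ (ε (k + 1)) (F' (μ k)) (μ k) (μ (k + 1))

/-- `ν` is a weak-* limit point of the iterates with `0 ∈ ∂[F + G](ν)`. -/
def IsOptimalLimitPoint (F : Meas Ω → ℝ) (α : ℝ) (μ : ℕ → Meas Ω) (ν : Meas Ω) : Prop :=
  IsWeakStarLimitPoint μ ν ∧ (0 : C(Ω, ℝ)) ∈ preSubdifferential (objective F α) ν

end

end MuFB

/-!
The argument is that of inexact forward-backward splitting in the "Hilbert" geometry of `‖·‖_𝒟`.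

*The seminorm.* A continuous integrable kernel with `ρ̂ ≥ 0` has an integrable transform
(`integrable_fourier_of_nonneg`), so that Fourier inversion holds and
`⟨𝒟μ, μ⟩ = ∫ ⟨φ_ξ, μ⟩² dξ ≥ 0` for features `φ_ξ` with `ρ(x - y) = ∫ φ_ξ(x) φ_ξ(y) dξ`
(`pairing_pairing_self_eq_integral_sq`). Hence `‖·‖_𝒟` is the seminorm of a semi-inner product and
satisfies the three-point identity.

*One step.* Insertion and adjustment solves the step problem (`Step.stepProblem`). Pairing the step
problem with `ν ≥ 0`, and using convexity of `F`, its smoothness and the three-point identity, gives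
with `E(μ) = F(μ) + α‖μ‖`
`τ(E(μᵏ⁺¹) - E(ν)) + ½‖ν - μᵏ⁺¹‖_𝒟² + ½(1 - τL)‖μᵏ⁺¹ - μᵏ‖_𝒟² ≤ ½‖ν - μᵏ‖_𝒟² + ε_{k+1}(‖ν‖ + κ)`
(`StepProblem.value_sub_le`).

*Values.* The choice `ν = μᵏ` shows, with the coercivity of the objective and a discrete Grönwall
inequality, that the iterates are bounded and that `E(μᵏ)` converges; summing the inequality for a
fixed `ν` shows that the limit is at most `E(ν)` (`exists_tendsto_value`). As `E` is weakly-* lower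
semicontinuous on non-negative measures, and bounded sequences of these are weakly-* sequentially
compact, every subsequence has a subsequence converging weakly-* to a minimiser
(`exists_subseq_optimal`).

*Limit points.* For a minimiser `ν` the inequality shows that `‖ν - μᵏ‖_𝒟` converges, and Opial's
argument gives that any two limit points among the minimisers have `𝒟`-distance zero
(`waveNorm_sub_eq_zero_of_tendsto`).

*Uniqueness.* If `ρ = u * u` with `u` real and square-integrable, then `û² = ρ̂ ≥ 0`, which forces
`u` to be even (`IsKernel.even_of_sqrt`). Hence `‖μ‖_𝒟` is the `L²` norm of `u * μ`. If it vanishes, `μ`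
annihilates all translates of `u`, so `μ = 0` when the translates are fundamental
(`IsKernel.eq_zero_of_waveNorm_eq_zero`).
-/

namespace MuFB

/-! ### The dual product -/

section Pairing

variable {n : ℕ} {Ω : Set (Space n)}

instance isFiniteMeasure_variation (μ : Meas Ω) : IsFiniteMeasure (VectorMeasure.variation μ) := by
  rw [← SignedMeasure.totalVariation_eq_variation]
  infer_instance

lemma radonNorm_nonneg (μ : Meas Ω) : 0 ≤ radonNorm μ := measureReal_nonneg

lemma radonNorm_smul (c : ℝ) (μ : Meas Ω) : radonNorm (c • μ) = |c| * radonNorm μ := by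
  simp [radonNorm, VectorMeasure.variation_smul, Measure.real]

lemma pairing_smul_right (f : Ω → ℝ) (c : ℝ) (μ : Meas Ω) :
    pairing f (c • μ) = c * pairing f μ := by
  simp [pairing, VectorMeasure.integral_smul_vectorMeasure]

lemma pairing_smul_left (f : Ω → ℝ) (c : ℝ) (μ : Meas Ω) :
    pairing (fun x => c * f x) μ = c * pairing f μ := by
  simpa [pairing] using VectorMeasure.integral_fun_smul μ (ContinuousLinearMap.lsmul ℝ ℝ).flip c f

lemma pairing_zero_left (μ : Meas Ω) : pairing (fun _ => 0) μ = 0 := by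
  simp [pairing]

lemma pairing_toSignedMeasure (f : Ω → ℝ) (P : Measure Ω) [IsFiniteMeasure P] :
    pairing f P.toSignedMeasure = ∫ x, f x ∂P := by
  simp [pairing]

lemma radonNorm_toSignedMeasure (P : Measure Ω) [IsFiniteMeasure P] :
    radonNorm P.toSignedMeasure = P.real Set.univ := by
  simp [radonNorm]

lemma exists_toSignedMeasure_sub (μ : Meas Ω) : ∃ P N : FiniteMeasure Ω,
    μ = (P : Measure Ω).toSignedMeasure - (N : Measure Ω).toSignedMeasure :=
  ⟨⟨μ.toJordanDecomposition.posPart, inferInstance⟩,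
    ⟨μ.toJordanDecomposition.negPart, inferInstance⟩,
    (SignedMeasure.toSignedMeasure_toJordanDecomposition μ).symm⟩

lemma exists_toSignedMeasure_of_nonneg {μ : Meas Ω} (h : 0 ≤ μ) : ∃ P : FiniteMeasure Ω,
    μ = (P : Measure Ω).toSignedMeasure := by
  have h' : VectorMeasure.restrict 0 Set.univ ≤ VectorMeasure.restrict μ Set.univ :=
    (VectorMeasure.le_restrict_univ_iff_le _ _).2 h
  exact ⟨⟨μ.toMeasureOfZeroLE Set.univ MeasurableSet.univ h', inferInstance⟩,
    (SignedMeasure.toMeasureOfZeroLE_toSignedMeasure μ h').symm⟩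

lemma toSignedMeasure_nonneg (P : Measure Ω) [IsFiniteMeasure P] :
    (0 : Meas Ω) ≤ P.toSignedMeasure :=
  Measure.zero_le_toSignedMeasure P

lemma radonNorm_eq_pairing_one {μ : Meas Ω} (h : 0 ≤ μ) :
    radonNorm μ = pairing (fun _ => 1) μ := by
  obtain ⟨P, rfl⟩ := exists_toSignedMeasure_of_nonneg h
  rw [radonNorm_toSignedMeasure, pairing_toSignedMeasure]
  simp

lemma abs_pairing_le {f : Ω → ℝ} {C : ℝ} (hC : ∀ x, |f x| ≤ C) (μ : Meas Ω) :
    |pairing f μ| ≤ C * radonNorm μ := by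
  rcases isEmpty_or_nonempty Ω with h | ⟨⟨x⟩⟩
  · have : μ = 0 := by
      ext s _
      rw [Set.eq_empty_of_isEmpty s]
      simp
    subst this
    simp [pairing, radonNorm]
  have hC0 : 0 ≤ C := (abs_nonneg _).trans (hC x)
  have h := VectorMeasure.norm_integral_le_of_norm_le_const (μ := μ) (f := f) (C := C)
    (B := (ContinuousLinearMap.lsmul ℝ ℝ).flip) (Eventually.of_forall fun x => by simpa using hC x)
  have h1 : ‖(ContinuousLinearMap.lsmul ℝ ℝ : ℝ →L[ℝ] ℝ →L[ℝ] ℝ).flip‖ ≤ 1 := by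
    rw [ContinuousLinearMap.opNorm_flip]
    exact ContinuousLinearMap.opNorm_lsmul_le
  rw [Real.norm_eq_abs] at h
  refine h.trans ?_
  have h2 := mul_le_mul_of_nonneg_left h1 hC0
  rw [mul_one] at h2
  exact mul_le_mul_of_nonneg_right h2 (radonNorm_nonneg μ)

variable [CompactSpace Ω]

lemma integrable_of_continuous {f : Ω → ℝ} (hf : Continuous f) (P : Measure Ω)
    [IsFiniteMeasure P] : Integrable f P :=
  hf.integrable_of_hasCompactSupport (HasCompactSupport.of_compactSpace f)

lemma pairing_add_left {f g : Ω → ℝ} (hf : Continuous f) (hg : Continuous g) (μ : Meas Ω) :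
    pairing (fun x => f x + g x) μ = pairing f μ + pairing g μ :=
  VectorMeasure.integral_fun_add (integrable_of_continuous hf _) (integrable_of_continuous hg _)

lemma pairing_sub_left {f g : Ω → ℝ} (hf : Continuous f) (hg : Continuous g) (μ : Meas Ω) :
    pairing (fun x => f x - g x) μ = pairing f μ - pairing g μ :=
  VectorMeasure.integral_fun_sub (integrable_of_continuous hf _) (integrable_of_continuous hg _)

lemma pairing_sub_right {f : Ω → ℝ} (hf : Continuous f) (μ ν : Meas Ω) :
    pairing f (μ - ν) = pairing f μ - pairing f ν :=
  VectorMeasure.integral_sub_vectorMeasure (integrable_of_continuous hf _)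
    (integrable_of_continuous hf _)

lemma pairing_mono {f g : Ω → ℝ} (hf : Continuous f) (hg : Continuous g) (h : ∀ x, f x ≤ g x)
    {μ : Meas Ω} (hμ : 0 ≤ μ) : pairing f μ ≤ pairing g μ := by
  obtain ⟨P, rfl⟩ := exists_toSignedMeasure_of_nonneg hμ
  rw [pairing_toSignedMeasure, pairing_toSignedMeasure]
  exact integral_mono (integrable_of_continuous hf _) (integrable_of_continuous hg _) h

/-- A signed measure is determined by its action on `C(Ω)`. -/
lemma eq_zero_of_pairing_eq_zero {μ : Meas Ω} (h : ∀ f : C(Ω, ℝ), pairing f μ = 0) : μ = 0 := by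
  obtain ⟨P, N, rfl⟩ := exists_toSignedMeasure_sub μ
  have hPN : (P : Measure Ω) = N := by
    refine ext_of_forall_integral_eq_of_IsFiniteMeasure fun f => ?_
    have := h f.toContinuousMap
    erw [pairing_sub_right f.continuous, pairing_toSignedMeasure, pairing_toSignedMeasure] at this
    exact sub_eq_zero.1 this
  rw [sub_eq_zero, Measure.toSignedMeasure_congr hPN]

lemma continuous_pairing_left (μ : Meas Ω) : Continuous fun f : C(Ω, ℝ) => pairing f μ := by
  refine continuous_iff_continuousAt.2 fun f => ?_
  rw [ContinuousAt, tendsto_iff_norm_sub_tendsto_zero]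
  have h0 : Tendsto (fun g : C(Ω, ℝ) => ‖g - f‖ * radonNorm μ) (𝓝 f) (𝓝 0) := by
    have : Continuous fun g : C(Ω, ℝ) => ‖g - f‖ * radonNorm μ := by fun_prop
    simpa using this.tendsto f
  refine squeeze_zero (fun _ => norm_nonneg _) (fun g => ?_) h0
  rw [Real.norm_eq_abs, ← pairing_sub_left g.continuous f.continuous]
  exact abs_pairing_le (fun x => (g - f).norm_coe_le_norm x) μ

end Pairing

/-! ### Weak-* compactness -/

section Compactness

variable {n : ℕ} {Ω : Set (Space n)} [CompactSpace Ω]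

/-- Bounded sequences of non-negative measures have weakly-* convergent subsequences. The measures
are factored as mass times probability measure, the space of probability measures on `Ω` being
compact and metrizable. -/
lemma exists_subseq_weakStarTendsto {μ : ℕ → Meas Ω} {C : ℝ} (hμ : ∀ k, 0 ≤ μ k)
    (hC : ∀ k, radonNorm (μ k) ≤ C) :
    ∃ ν : Meas Ω, 0 ≤ ν ∧ ∃ s : ℕ → ℕ, StrictMono s ∧ WeakStarTendsto (fun j => μ (s j)) ν := by
  choose P hP using fun k => exists_toSignedMeasure_of_nonneg (hμ k)
  rcases isEmpty_or_nonempty Ω with hΩ | hΩ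
  · refine ⟨0, le_rfl, id, strictMono_id, fun f => ?_⟩
    have h0 : ∀ m : Meas Ω, m = 0 := fun m => by
      ext s _
      rw [Set.eq_empty_of_isEmpty s]
      simp
    simp [h0 (μ _)]
  obtain ⟨Q, -, s, hs, hQ⟩ := isCompact_univ.tendsto_subseq (x := fun k => (P k).normalize)
    (fun k => Set.mem_univ _)
  have hmass : ∀ k, (P (s k)).mass.toReal ∈ Set.Icc 0 C := fun k => by
    refine ⟨NNReal.coe_nonneg _, ?_⟩
    have := hC (s k)
    rw [hP, radonNorm_toSignedMeasure] at this
    exact this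
  obtain ⟨m, hm, t, ht, hmt⟩ := isCompact_Icc.tendsto_subseq hmass
  lift m to NNReal using hm.1
  refine ⟨((m • Q.toFiniteMeasure : FiniteMeasure Ω) : Measure Ω).toSignedMeasure,
    toSignedMeasure_nonneg _, s ∘ t, hs.comp ht, fun f => ?_⟩
  have hQt := hQ.comp ht.tendsto_atTop
  rw [ProbabilityMeasure.tendsto_iff_forall_integral_tendsto] at hQt
  have h := hmt.mul (hQt (BoundedContinuousFunction.mkOfCompact f))
  have key : ∀ (c : NNReal) (R : ProbabilityMeasure Ω) ,
      ∫ x, f x ∂((c • R.toFiniteMeasure : FiniteMeasure Ω) : Measure Ω)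
        = c * ∫ x, f x ∂(R : Measure Ω) := fun c R => by
    rw [FiniteMeasure.toMeasure_smul, integral_smul_nnreal_measure]
    rfl
  rw [pairing_toSignedMeasure, key]
  refine h.congr fun j => ?_
  simp only [Function.comp_apply]
  rw [hP, pairing_toSignedMeasure]
  conv_rhs => rw [(P (s (t j))).self_eq_mass_smul_normalize]
  rw [key]
  rfl

end Compactness

/-! ### Kernels with a feature map -/

section Feature

variable {n : ℕ} {Ω : Set (Space n)} [CompactSpace Ω]

lemma exists_abs_le_of_continuous {X : Type*} [TopologicalSpace X] [CompactSpace X] {f : X → ℝ}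
    (hf : Continuous f) : ∃ C, ∀ x, |f x| ≤ C := by
  obtain ⟨C, hC⟩ := (isCompact_range hf).isBounded.exists_norm_le
  exact ⟨C, fun x => hC _ ⟨x, rfl⟩⟩

lemma continuous_pairing_of_continuous {K : Ω → Ω → ℝ} (hK : Continuous (Function.uncurry K))
    (μ : Meas Ω) : Continuous fun x => pairing (K x) μ := by
  obtain ⟨C, hC⟩ := exists_abs_le_of_continuous hK
  refine VectorMeasure.continuous_of_dominated (bound := fun _ => C) (fun x => ?_)
    (fun x => Eventually.of_forall fun y => hC (x, y)) (integrable_const C)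
    (Eventually.of_forall fun y => ?_)
  · exact (hK.comp (Continuous.prodMk_right x)).aestronglyMeasurable
  · exact hK.comp (Continuous.prodMk_left y)

omit [CompactSpace Ω] in
lemma pairing_pairing_toSignedMeasure (K : Ω → Ω → ℝ) (P Q : Measure Ω) [IsFiniteMeasure P]
    [IsFiniteMeasure Q] :
    pairing (fun x => pairing (K x) P.toSignedMeasure) Q.toSignedMeasure
      = ∫ x, ∫ y, K x y ∂P ∂Q := by
  simp only [pairing_toSignedMeasure]

lemma pairing_pairing_sub {K : Ω → Ω → ℝ} (hK : Continuous (Function.uncurry K))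
    (μ₁ μ₂ ν₁ ν₂ : Meas Ω) :
    pairing (fun x => pairing (K x) (μ₁ - μ₂)) (ν₁ - ν₂)
      = pairing (fun x => pairing (K x) μ₁) ν₁ - pairing (fun x => pairing (K x) μ₂) ν₁
        - (pairing (fun x => pairing (K x) μ₁) ν₂ - pairing (fun x => pairing (K x) μ₂) ν₂) := by
  have h1 : ∀ x, pairing (K x) (μ₁ - μ₂) = pairing (K x) μ₁ - pairing (K x) μ₂ := fun x =>
    pairing_sub_right (hK.comp (Continuous.prodMk_right x)) _ _
  simp only [h1]
  have c1 := continuous_pairing_of_continuous hK μ₁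
  have c2 := continuous_pairing_of_continuous hK μ₂
  rw [pairing_sub_right (c1.fun_sub c2), pairing_sub_left c1 c2, pairing_sub_left c1 c2]

lemma pairing_pairing_comm {K : Ω → Ω → ℝ} (hK : Continuous (Function.uncurry K))
    (hsymm : ∀ x y, K x y = K y x) (μ ν : Meas Ω) :
    pairing (fun x => pairing (K x) μ) ν = pairing (fun x => pairing (K x) ν) μ := by
  have key : ∀ P Q : FiniteMeasure Ω,
      pairing (fun x => pairing (K x) (P : Measure Ω).toSignedMeasure)
        (Q : Measure Ω).toSignedMeasure
      = pairing (fun x => pairing (K x) (Q : Measure Ω).toSignedMeasure)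
        (P : Measure Ω).toSignedMeasure := fun P Q => by
    rw [pairing_pairing_toSignedMeasure, pairing_pairing_toSignedMeasure, integral_integral_swap]
    · simp only [hsymm]
    · exact hK.integrable_of_hasCompactSupport (HasCompactSupport.of_compactSpace _)
  obtain ⟨P, N, rfl⟩ := exists_toSignedMeasure_sub μ
  obtain ⟨P', N', rfl⟩ := exists_toSignedMeasure_sub ν
  rw [pairing_pairing_sub hK, pairing_pairing_sub hK, key P P', key N P', key P N', key N N']
  ring

variable {Z : Type*} [TopologicalSpace Z] [MeasurableSpace Z]
  [BorelSpace Z] {m : Measure Z} [SFinite m] {φ : Z → Ω → ℝ} {C : ℝ}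

lemma integrable_feature_mul (hφ : Continuous (Function.uncurry φ))
    (hint : ∀ x, Integrable (fun z => φ z x ^ 2) m) (hC : ∀ x, ∫ z, φ z x ^ 2 ∂m ≤ C)
    (P Q : Measure Ω) [IsFiniteMeasure P] [IsFiniteMeasure Q] :
    Integrable (fun p : Z × Ω × Ω => φ p.1 p.2.1 * φ p.1 p.2.2) (m.prod (P.prod Q)) := by
  have hsq : ∀ g : Ω × Ω → Ω, Continuous g →
      Integrable (fun p : Z × Ω × Ω => φ p.1 (g p.2) ^ 2) (m.prod (P.prod Q)) := fun g hg => by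
    have hc : Continuous fun p : Z × Ω × Ω => φ p.1 (g p.2) ^ 2 :=
      (hφ.comp (continuous_fst.prodMk (hg.comp continuous_snd))).pow 2
    have hm : AEStronglyMeasurable (fun p : Z × Ω × Ω => φ p.1 (g p.2) ^ 2) (m.prod (P.prod Q)) :=
      hc.aestronglyMeasurable
    rw [integrable_prod_iff' hm]
    refine ⟨Eventually.of_forall fun y => hint (g y), ?_⟩
    refine Integrable.of_bound hm.norm.prod_swap.integral_prod_right' C
      (Eventually.of_forall fun y => ?_)
    simp only [norm_pow, Real.norm_eq_abs, sq_abs]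
    rw [abs_of_nonneg (integral_nonneg fun z => sq_nonneg _)]
    exact hC (g y)
  refine ((hsq _ continuous_fst).add (hsq _ continuous_snd)).mono' ?_
    (Eventually.of_forall fun p => ?_)
  · exact Continuous.aestronglyMeasurable
      ((hφ.comp (continuous_fst.prodMk (continuous_fst.comp continuous_snd))).mul
        (hφ.comp (continuous_fst.prodMk (continuous_snd.comp continuous_snd))))
  · rw [Real.norm_eq_abs, abs_mul, Pi.add_apply, ← sq_abs (φ p.1 p.2.1), ← sq_abs (φ p.1 p.2.2)]
    nlinarith [sq_nonneg (|φ p.1 p.2.1| - |φ p.1 p.2.2|), sq_nonneg (|φ p.1 p.2.1|),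
      sq_nonneg (|φ p.1 p.2.2|)]

lemma integral_integral_feature (hφ : Continuous (Function.uncurry φ))
    (hint : ∀ x, Integrable (fun z => φ z x ^ 2) m) (hC : ∀ x, ∫ z, φ z x ^ 2 ∂m ≤ C)
    (P Q : Measure Ω) [IsFiniteMeasure P] [IsFiniteMeasure Q] :
    Integrable (fun z => (∫ x, φ z x ∂P) * ∫ y, φ z y ∂Q) m ∧
      ∫ x, ∫ y, ∫ z, φ z x * φ z y ∂m ∂Q ∂P = ∫ z, (∫ x, φ z x ∂P) * ∫ y, φ z y ∂Q ∂m := by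
  have h := integrable_feature_mul hφ hint hC P Q
  have hz : ∀ z, ∫ p : Ω × Ω, φ z p.1 * φ z p.2 ∂(P.prod Q)
      = (∫ x, φ z x ∂P) * ∫ y, φ z y ∂Q := fun z => integral_prod_mul (φ z) (φ z)
  constructor
  · simpa only [hz] using h.integral_prod_left
  · have e := integral_integral_swap (f := fun z (p : Ω × Ω) => φ z p.1 * φ z p.2) h
    simp only [hz] at e
    rw [e]
    exact (integral_prod _ h.integral_prod_right).symm

/-- If a kernel is given by the `L²` inner products of features, `K(x, y) = ⟨φ(·, x), φ(·, y)⟩`,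
then its quadratic form is the square of the `L²` norm of `z ↦ ⟨φ(z, ·), μ⟩`. -/
lemma pairing_pairing_self_eq_integral_sq {K : Ω → Ω → ℝ} (hK : Continuous (Function.uncurry K))
    (hφ : Continuous (Function.uncurry φ))
    (hint : ∀ x, Integrable (fun z => φ z x ^ 2) m) (hC : ∀ x, ∫ z, φ z x ^ 2 ∂m ≤ C)
    (hKφ : ∀ x y, K x y = ∫ z, φ z x * φ z y ∂m) (μ : Meas Ω) :
    Integrable (fun z => pairing (φ z) μ ^ 2) m ∧
      pairing (fun x => pairing (K x) μ) μ = ∫ z, pairing (φ z) μ ^ 2 ∂m := by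
  obtain ⟨P, N, rfl⟩ := exists_toSignedMeasure_sub μ
  have hz : ∀ z, pairing (φ z) ((P : Measure Ω).toSignedMeasure - (N : Measure Ω).toSignedMeasure)
      = ∫ x, φ z x ∂(P : Measure Ω) - ∫ x, φ z x ∂(N : Measure Ω) := fun z => by
    rw [pairing_sub_right (f := φ z) (hφ.comp (Continuous.prodMk_right z)), pairing_toSignedMeasure,
      pairing_toSignedMeasure]
  obtain ⟨i1, e1⟩ := integral_integral_feature hφ hint hC (P : Measure Ω) (P : Measure Ω)
  obtain ⟨i2, e2⟩ := integral_integral_feature hφ hint hC (P : Measure Ω) (N : Measure Ω)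
  obtain ⟨i3, e3⟩ := integral_integral_feature hφ hint hC (N : Measure Ω) (P : Measure Ω)
  obtain ⟨i4, e4⟩ := integral_integral_feature hφ hint hC (N : Measure Ω) (N : Measure Ω)
  have hsq : ∀ a b : ℝ, (a - b) ^ 2 = a * a - b * a - (a * b - b * b) := fun a b => by ring
  simp only [hz, hsq]
  have i13 : Integrable (fun z => (∫ x, φ z x ∂(P : Measure Ω)) * ∫ x, φ z x ∂(P : Measure Ω)
      - (∫ x, φ z x ∂(N : Measure Ω)) * ∫ x, φ z x ∂(P : Measure Ω)) m := i1.sub i3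
  have i24 : Integrable (fun z => (∫ x, φ z x ∂(P : Measure Ω)) * ∫ x, φ z x ∂(N : Measure Ω)
      - (∫ x, φ z x ∂(N : Measure Ω)) * ∫ x, φ z x ∂(N : Measure Ω)) m := i2.sub i4
  refine ⟨i13.sub i24, ?_⟩
  rw [pairing_pairing_sub hK]
  simp only [pairing_pairing_toSignedMeasure, hKφ]
  rw [integral_sub i13 i24, integral_sub i1 i3, integral_sub i2 i4, e1, e2, e3, e4]
  ring

end Feature

/-! ### Kernels with a non-negative Fourier transform -/

section Fourier

open Module in
/-- A continuous integrable function with a non-negative Fourier transform has an integrable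
Fourier transform. The integrals of the transform against Gaussians converge to the value at the
origin, so that Fatou's lemma applies. -/
lemma integrable_fourier_of_nonneg {V : Type*} [NormedAddCommGroup V] [InnerProductSpace ℝ V]
    [FiniteDimensional ℝ V] [MeasurableSpace V] [BorelSpace V] {f : V → ℂ} (hf : Integrable f)
    (hc : Continuous f) {g : V → ℝ} (hg : ∀ ξ, 𝓕 f ξ = g ξ) (hg0 : ∀ ξ, 0 ≤ g ξ) :
    Integrable (𝓕 f) := by
  have hFc : Continuous (𝓕 f) :=
    VectorFourier.fourierIntegral_continuous Real.continuous_fourierChar continuous_inner hf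
  have hgc : Continuous g := by
    have : g = fun ξ => (𝓕 f ξ).re := by ext ξ; rw [hg]; simp
    rw [this]; exact Complex.continuous_re.comp hFc
  have hgauss : ∀ c : ℝ, 0 < c → Integrable (fun w : V => Complex.exp (-(c : ℂ)⁻¹ * ‖w‖ ^ 2)) :=
    fun c hc => by
      simpa using GaussianFourier.integrable_cexp_neg_mul_sq_norm_add (V := V)
        (b := (c : ℂ)⁻¹) (by simpa using hc) 0 0
  have hlim : Tendsto (fun c : ℝ => ∫ w : V, Complex.exp (-(c : ℂ)⁻¹ * ‖w‖ ^ 2) • 𝓕 f w) atTop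
      (𝓝 (f 0)) := by
    refine (Real.tendsto_integral_gaussian_smul' hf (hc.continuousAt (x := 0))).congr' ?_
    filter_upwards [Ioi_mem_atTop 0] with c (hc : 0 < c)
    have e := VectorFourier.integral_fourierIntegral_smul_eq_flip (L := innerₗ V)
      Real.continuous_fourierChar continuous_inner (hgauss c hc) hf
    rw [flip_innerₗ] at e
    refine Eq.trans ?_ e
    congr with w
    congr 1
    have := fourier_gaussian_innerProductSpace' (V := V) (b := (c : ℂ)⁻¹) (by simpa using hc) 0 w
    simp only [inner_zero_left, Complex.ofReal_zero, mul_zero, add_zero] at this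
    refine Eq.trans ?_ this.symm
    rw [div_inv_eq_mul, div_inv_eq_mul]
    ring_nf
  have hreal : ∀ c : ℝ, ∫ w : V, Complex.exp (-(c : ℂ)⁻¹ * ‖w‖ ^ 2) • 𝓕 f w
      = ((∫ w : V, Real.exp (-c⁻¹ * ‖w‖ ^ 2) * g w : ℝ) : ℂ) := fun c => by
    rw [← integral_complex_ofReal]
    congr with w
    rw [hg]
    push_cast
    rfl
  simp only [hreal] at hlim
  have hlim' := (Complex.continuous_re.tendsto _).comp
    (hlim.comp (tendsto_natCast_atTop_atTop (R := ℝ)))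
  simp only [Function.comp_def, Complex.ofReal_re] at hlim'
  -- Fatou's lemma for the Gaussian weights `exp (-‖w‖ ^ 2 / k)`, which increase to `1`
  have hle : ∫⁻ w : V, ENNReal.ofReal (g w) ≤ ENNReal.ofReal (f 0).re := by
    have hpt : ∀ w : V, ENNReal.ofReal (g w)
        = liminf (fun k : ℕ => ENNReal.ofReal (Real.exp (-(k : ℝ)⁻¹ * ‖w‖ ^ 2) * g w)) atTop :=
      fun w => by
        refine (Tendsto.liminf_eq (ENNReal.tendsto_ofReal ?_)).symm
        have h1 : Tendsto (fun k : ℕ => Real.exp (-(k : ℝ)⁻¹ * ‖w‖ ^ 2) * g w) atTop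
            (𝓝 (Real.exp (-0 * ‖w‖ ^ 2) * g w)) :=
          (((Real.continuous_exp.tendsto _).comp
            ((tendsto_inv_atTop_nhds_zero_nat (𝕜 := ℝ)).neg.mul_const (‖w‖ ^ 2))).mul_const (g w))
        simpa using h1
    calc ∫⁻ w : V, ENNReal.ofReal (g w)
        = ∫⁻ w : V, liminf (fun k : ℕ =>
            ENNReal.ofReal (Real.exp (-(k : ℝ)⁻¹ * ‖w‖ ^ 2) * g w)) atTop := by simp only [← hpt]
      _ ≤ liminf (fun k : ℕ => ∫⁻ w : V,
            ENNReal.ofReal (Real.exp (-(k : ℝ)⁻¹ * ‖w‖ ^ 2) * g w)) atTop :=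
          lintegral_liminf_le fun k => by fun_prop
      _ = ENNReal.ofReal (f 0).re := by
          refine Tendsto.liminf_eq ((ENNReal.tendsto_ofReal hlim').congr' ?_)
          filter_upwards [eventually_gt_atTop 0] with k hk
          rw [ofReal_integral_eq_lintegral_ofReal]
          · have hb := (hgauss k (by exact_mod_cast hk)).mul_bdd (c := ∫ v, ‖f v‖)
              hFc.aestronglyMeasurable (Eventually.of_forall fun w =>
                VectorFourier.norm_fourierIntegral_le_integral_norm _ _ _ _ _)
            refine hb.re.congr (Eventually.of_forall fun w => ?_)
            simp only [hg]
            have : Complex.exp (-((k : ℝ) : ℂ)⁻¹ * ‖w‖ ^ 2) * (g w : ℂ)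
              = ((Real.exp (-(k : ℝ)⁻¹ * ‖w‖ ^ 2) * g w : ℝ) : ℂ) := by push_cast; rfl
            rw [this]
            exact Complex.ofReal_re _
          · exact Eventually.of_forall fun w => mul_nonneg (Real.exp_pos _).le (hg0 w)
  have hgi : Integrable g := by
    refine ⟨hgc.aestronglyMeasurable, ?_⟩
    rw [hasFiniteIntegral_iff_ofReal (Eventually.of_forall hg0)]
    exact hle.trans_lt ENNReal.ofReal_lt_top
  have : 𝓕 f = fun ξ => ((g ξ : ℝ) : ℂ) := funext hg
  rw [this]
  exact hgi.ofReal

variable {n : ℕ} {ρ : Space n → ℝ}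

/-- The spectral density of a kernel: its Fourier transform, as a real function. -/
noncomputable def spectral (ρ : Space n → ℝ) (ξ : Space n) : ℝ :=
  (𝓕 (fun x : Space n => (ρ x : ℂ)) ξ).re

lemma IsKernel.integrable (hρ : IsKernel ρ) : Integrable (fun x => (ρ x : ℂ)) :=
  (hρ.continuous.integrable_of_hasCompactSupport hρ.hasCompactSupport).ofReal

/-- The Fourier transform of an even real function is real. -/
lemma IsKernel.fourier_eq (hρ : IsKernel ρ) (ξ : Space n) :
    𝓕 (fun x : Space n => (ρ x : ℂ)) ξ = spectral ρ ξ := by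
  refine (Complex.conj_eq_iff_re.1 ?_).symm
  rw [Real.fourier_eq', ← integral_conj, ← integral_neg_eq_self]
  congr with x
  simp only [smul_eq_mul, map_mul, ← Complex.exp_conj, Complex.conj_ofReal, Complex.conj_I,
    hρ.symmetric, inner_neg_left]
  congr 2
  push_cast
  ring

lemma IsKernel.integrable_fourier (hρ : IsKernel ρ) :
    Integrable (𝓕 (fun x : Space n => (ρ x : ℂ))) :=
  integrable_fourier_of_nonneg hρ.integrable (Complex.continuous_ofReal.comp hρ.continuous)
    hρ.fourier_eq hρ.fourier_nonneg

lemma IsKernel.integrable_spectral (hρ : IsKernel ρ) : Integrable (spectral ρ) :=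
  hρ.integrable_fourier.re

lemma IsKernel.continuous_spectral (hρ : IsKernel ρ) : Continuous (spectral ρ) :=
  Complex.continuous_re.comp (VectorFourier.fourierIntegral_continuous Real.continuous_fourierChar
    continuous_inner hρ.integrable)

/-- Fourier inversion for the kernel. -/
lemma IsKernel.eq_integral_exp (hρ : IsKernel ρ) (x : Space n) :
    (ρ x : ℂ) = ∫ ξ, Complex.exp (↑(2 * Real.pi * inner ℝ ξ x) * Complex.I) * spectral ρ ξ := by
  have h := (Complex.continuous_ofReal.comp hρ.continuous).fourierInv_fourier_eq
    hρ.integrable hρ.integrable_fourier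
  have h := congrFun h x
  rw [Function.comp_apply] at h
  rw [← h, Real.fourierInv_eq']
  congr with ξ
  rw [smul_eq_mul]
  congr 1
  exact hρ.fourier_eq ξ

lemma IsKernel.integral_spectral (hρ : IsKernel ρ) : ∫ ξ, spectral ρ ξ = ρ 0 := by
  have h := hρ.eq_integral_exp 0
  simp only [inner_zero_right, mul_zero, Complex.ofReal_zero, zero_mul, Complex.exp_zero,
    one_mul] at h
  rw [integral_complex_ofReal] at h
  exact_mod_cast h.symm

/-- The features of the kernel, `√ρ̂(ξ) (cos + sin)(2π⟨ξ, x⟩)`. Since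
`(cos + sin)(a) (cos + sin)(b) = cos(a - b) + sin(a + b)`, and the sine integrates to the imaginary
part of `ρ(x + y)`, their `L²` inner products are `ρ(x - y)`. -/
noncomputable def feature (ρ : Space n → ℝ) (ξ x : Space n) : ℝ :=
  √(spectral ρ ξ) *
    (Real.cos (2 * Real.pi * inner ℝ ξ x) + Real.sin (2 * Real.pi * inner ℝ ξ x))

lemma IsKernel.feature_mul (hρ : IsKernel ρ) (ξ x y : Space n) :
    feature ρ ξ x * feature ρ ξ y
      = Real.cos (2 * Real.pi * inner ℝ ξ (x - y)) * spectral ρ ξ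
        + Real.sin (2 * Real.pi * inner ℝ ξ (x + y)) * spectral ρ ξ := by
  have h : √(spectral ρ ξ) * √(spectral ρ ξ) = spectral ρ ξ :=
    Real.mul_self_sqrt (hρ.fourier_nonneg ξ)
  simp only [feature, inner_sub_right, inner_add_right, mul_sub, mul_add, Real.cos_sub,
    Real.sin_add]
  linear_combination
    (Real.cos (2 * Real.pi * inner ℝ ξ x) + Real.sin (2 * Real.pi * inner ℝ ξ x))
      * (Real.cos (2 * Real.pi * inner ℝ ξ y) + Real.sin (2 * Real.pi * inner ℝ ξ y)) * h

lemma IsKernel.integral_feature_mul (hρ : IsKernel ρ) (x y : Space n) :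
    Integrable (fun ξ => feature ρ ξ x * feature ρ ξ y) ∧
      ρ (x - y) = ∫ ξ, feature ρ ξ x * feature ρ ξ y := by
  have hi : ∀ z : Space n, Integrable fun ξ =>
      Complex.exp (↑(2 * Real.pi * inner ℝ ξ z) * Complex.I) * (spectral ρ ξ : ℂ) := fun z =>
    hρ.integrable_spectral.ofReal.bdd_mul (c := 1)
      (Continuous.aestronglyMeasurable (by fun_prop))
      (Eventually.of_forall fun ξ => by rw [Complex.norm_exp_ofReal_mul_I])
  have hre : ∀ z ξ : Space n,
      (Complex.exp (↑(2 * Real.pi * inner ℝ ξ z) * Complex.I) * (spectral ρ ξ : ℂ)).re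
        = Real.cos (2 * Real.pi * inner ℝ ξ z) * spectral ρ ξ := fun z ξ => by
    rw [Complex.re_mul_ofReal, Complex.exp_ofReal_mul_I_re]
  have him : ∀ z ξ : Space n,
      (Complex.exp (↑(2 * Real.pi * inner ℝ ξ z) * Complex.I) * (spectral ρ ξ : ℂ)).im
        = Real.sin (2 * Real.pi * inner ℝ ξ z) * spectral ρ ξ := fun z ξ => by
    rw [Complex.im_mul_ofReal, Complex.exp_ofReal_mul_I_im]
  have hcos := (hi (x - y)).re
  have hsin := (hi (x + y)).im
  simp only [RCLike.re_to_complex, RCLike.im_to_complex, hre, him] at hcos hsin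
  have ecos : ρ (x - y) = ∫ ξ, Real.cos (2 * Real.pi * inner ℝ ξ (x - y)) * spectral ρ ξ := by
    have h := congrArg Complex.re (hρ.eq_integral_exp (x - y))
    rw [Complex.ofReal_re, ← RCLike.re_to_complex, ← integral_re (hi _)] at h
    simpa only [RCLike.re_to_complex, hre] using h
  have esin : 0 = ∫ ξ, Real.sin (2 * Real.pi * inner ℝ ξ (x + y)) * spectral ρ ξ := by
    have h := congrArg Complex.im (hρ.eq_integral_exp (x + y))
    rw [Complex.ofReal_im, ← RCLike.im_to_complex, ← integral_im (hi _)] at h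
    simpa only [RCLike.im_to_complex, him] using h
  simp only [hρ.feature_mul]
  refine ⟨hcos.add hsin, ?_⟩
  rw [integral_add hcos hsin, ← ecos, ← esin, add_zero]

end Fourier

/-! ### The particle-to-wave seminorm -/

section Wave

variable {n : ℕ} {Ω : Set (Space n)} [CompactSpace Ω] {ρ : Space n → ℝ}

omit [CompactSpace Ω] in
lemma IsKernel.continuous_sub (hρ : IsKernel ρ) :
    Continuous (Function.uncurry fun x y : Ω => ρ ((x : Space n) - (y : Space n))) :=
  hρ.continuous.comp (by fun_prop)

lemma IsKernel.continuous_waveOp (hρ : IsKernel ρ) (μ : Meas Ω) : Continuous (waveOp ρ μ) :=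
  continuous_pairing_of_continuous hρ.continuous_sub μ

lemma IsKernel.waveOp_sub (hρ : IsKernel ρ) (μ ν : Meas Ω) (x : Ω) :
    waveOp ρ (μ - ν) x = waveOp ρ μ x - waveOp ρ ν x :=
  pairing_sub_right (hρ.continuous_sub.comp (Continuous.prodMk_right x)) _ _

lemma IsKernel.pairing_waveOp_comm (hρ : IsKernel ρ) (μ ν : Meas Ω) :
    pairing (waveOp ρ μ) ν = pairing (waveOp ρ ν) μ :=
  pairing_pairing_comm hρ.continuous_sub (fun x y => by rw [← hρ.symmetric, neg_sub]) μ ν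

lemma IsKernel.pairing_waveOp_sub_left (hρ : IsKernel ρ) (μ₁ μ₂ ν : Meas Ω) :
    pairing (waveOp ρ (μ₁ - μ₂)) ν = pairing (waveOp ρ μ₁) ν - pairing (waveOp ρ μ₂) ν := by
  rw [hρ.pairing_waveOp_comm, pairing_sub_right (hρ.continuous_waveOp ν),
    hρ.pairing_waveOp_comm, hρ.pairing_waveOp_comm ν]

/-- The kernel is positive semidefinite on signed measures. -/
lemma IsKernel.pairing_waveOp_self_nonneg (hρ : IsKernel ρ) (μ : Meas Ω) :
    0 ≤ pairing (waveOp ρ μ) μ := by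
  have hφ : Continuous (Function.uncurry fun (ξ : Space n) (x : Ω) => feature ρ ξ x) := by
    have := hρ.continuous_spectral
    unfold feature
    fun_prop
  have h := (pairing_pairing_self_eq_integral_sq (m := volume)
    (φ := fun ξ (x : Ω) => feature ρ ξ x) (C := ρ 0) hρ.continuous_sub hφ
    (fun x => by simpa only [sq] using (hρ.integral_feature_mul x x).1)
    (fun x => by simpa only [sq, sub_self] using (hρ.integral_feature_mul x x).2.ge)
    (fun x y => (hρ.integral_feature_mul x y).2) μ).2
  exact h ▸ integral_nonneg fun ξ => sq_nonneg _

lemma IsKernel.waveNorm_sq (hρ : IsKernel ρ) (μ : Meas Ω) :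
    waveNorm ρ μ ^ 2 = pairing (waveOp ρ μ) μ :=
  Real.sq_sqrt (hρ.pairing_waveOp_self_nonneg μ)

omit [CompactSpace Ω] in
lemma waveNorm_zero : waveNorm ρ (0 : Meas Ω) = 0 := by
  simp [waveNorm, pairing]

/-- The three-point identity. -/
lemma IsKernel.pairing_waveOp_sub_sub (hρ : IsKernel ρ) (μ μ' ν : Meas Ω) :
    pairing (waveOp ρ (μ' - μ)) (ν - μ')
      = (waveNorm ρ (ν - μ) ^ 2 - waveNorm ρ (ν - μ') ^ 2 - waveNorm ρ (μ' - μ) ^ 2) / 2 := by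
  simp only [hρ.waveNorm_sq, hρ.pairing_waveOp_sub_left,
    pairing_sub_right (hρ.continuous_waveOp _)]
  rw [hρ.pairing_waveOp_comm ν μ, hρ.pairing_waveOp_comm ν μ', hρ.pairing_waveOp_comm μ' μ]
  ring

end Wave

/-! ### Convolution squares of square-integrable functions -/

section Autoconv

open scoped SchwartzMap ENNReal ContDiff

variable {n : ℕ}

/-- The convolution square `a * a` of a square-integrable function. -/
noncomputable def autoconv (a : Lp ℂ 2 (volume : Measure (Space n))) (x : Space n) : ℂ :=
  ∫ y, a y * a (x - y)

lemma measurePreserving_sub_left' (x : Space n) :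
    MeasurePreserving (fun y : Space n => x - y) volume volume :=
  Measure.measurePreserving_sub_left volume x

lemma autoconv_eq_lpPairing (a : Lp ℂ 2 (volume : Measure (Space n))) (x : Space n) :
    autoconv a x = (ContinuousLinearMap.mul ℂ ℂ).lpPairing volume 2 2 a
      (Lp.compMeasurePreserving _ (measurePreserving_sub_left' x) a) := by
  rw [ContinuousLinearMap.lpPairing_eq_integral]
  refine integral_congr_ae ?_
  filter_upwards [Lp.coeFn_compMeasurePreserving a (measurePreserving_sub_left' x)] with y hy
  rw [hy]
  rfl

lemma norm_autoconv_le (a : Lp ℂ 2 (volume : Measure (Space n))) (x : Space n) :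
    ‖autoconv a x‖
      ≤ ‖(ContinuousLinearMap.mul ℂ ℂ).lpPairing (volume : Measure (Space n)) 2 2‖ * ‖a‖ * ‖a‖ := by
  rw [autoconv_eq_lpPairing]
  refine (ContinuousLinearMap.le_opNorm₂ _ _ _).trans_eq ?_
  rw [Lp.norm_compMeasurePreserving]

lemma continuous_autoconv (x : Space n) :
    Continuous fun a : Lp ℂ 2 (volume : Measure (Space n)) => autoconv a x := by
  simp only [autoconv_eq_lpPairing]
  exact (ContinuousLinearMap.continuous
    (ContinuousLinearMap.lpPairing volume 2 2 (ContinuousLinearMap.mul ℂ ℂ))).clm_apply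
    (Lp.isometry_compMeasurePreserving (measurePreserving_sub_left' x)).continuous

lemma aestronglyMeasurable_autoconv (a : Lp ℂ 2 (volume : Measure (Space n))) :
    AEStronglyMeasurable (autoconv a) volume := by
  have h : StronglyMeasurable (fun p : Space n × Space n => a p.2 * a (p.1 - p.2)) :=
    ((Lp.stronglyMeasurable a).comp_measurable measurable_snd).mul
      ((Lp.stronglyMeasurable a).comp_measurable (measurable_fst.sub measurable_snd))
  exact h.integral_prod_right'.aestronglyMeasurable

lemma continuous_integral_autoconv {g : Space n → ℂ} (hg : Integrable g) :
    Continuous fun a : Lp ℂ 2 (volume : Measure (Space n)) => ∫ x, autoconv a x * g x := by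
  refine continuous_iff_continuousAt.2 fun a => ?_
  set M := ‖(ContinuousLinearMap.mul ℂ ℂ).lpPairing (volume : Measure (Space n)) 2 2‖
  refine continuousAt_of_dominated (bound := fun x => M * (‖a‖ + 1) * (‖a‖ + 1) * ‖g x‖)
    (Eventually.of_forall fun b => (aestronglyMeasurable_autoconv b).mul hg.1) ?_
    (hg.norm.const_mul _)
    (Eventually.of_forall fun x => ((continuous_autoconv x).mul continuous_const).continuousAt)
  filter_upwards [continuous_norm.continuousAt.eventually_lt continuousAt_const (lt_add_one ‖a‖)]
    with b hb
  refine Eventually.of_forall fun x => ?_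
  rw [norm_mul]
  gcongr
  exact (norm_autoconv_le b x).trans (by gcongr)

lemma continuous_integral_fourier_sq {ψ : Space n → ℂ} (hψ : MemLp ψ ∞ volume) :
    Continuous fun a : Lp ℂ 2 (volume : Measure (Space n)) =>
      ∫ ξ, (𝓕 a : Lp ℂ 2 _) ξ * (𝓕 a : Lp ℂ 2 _) ξ * ψ ξ := by
  have e : ∀ b : Lp ℂ 2 (volume : Measure (Space n)), ∫ ξ, b ξ * b ξ * ψ ξ
      = (ContinuousLinearMap.mul ℂ ℂ).lpPairing volume 2 2 b
          ((ContinuousLinearMap.mul ℂ ℂ).holderL volume ∞ 2 2 (hψ.toLp ψ) b) := fun b => by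
    rw [ContinuousLinearMap.lpPairing_eq_integral]
    refine integral_congr_ae ?_
    filter_upwards [(ContinuousLinearMap.mul ℂ ℂ).coeFn_holder (r := 2) (hψ.toLp ψ) b,
      hψ.coeFn_toLp] with ξ h1 h2
    have h1' : ((ContinuousLinearMap.mul ℂ ℂ).holderL volume ∞ 2 2 (hψ.toLp ψ) b : Lp ℂ 2 _) ξ
      = ψ ξ * b ξ := by
      rw [← h2]; exact h1
    rw [h1', ContinuousLinearMap.mul_apply']
    ring
  simp only [e]
  have hF : Continuous fun a : Lp ℂ 2 (volume : Measure (Space n)) => (𝓕 a : Lp ℂ 2 _) :=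
    (Lp.fourierTransformₗᵢ (Space n) ℂ).continuous
  exact (((ContinuousLinearMap.lpPairing volume 2 2 (ContinuousLinearMap.mul ℂ ℂ)).continuous).comp
    hF).clm_apply ((ContinuousLinearMap.continuous _).comp hF)

/-- The convolution theorem for `L²`, tested against Schwartz functions. -/
lemma integral_fourier_sq_mul (a : Lp ℂ 2 (volume : Measure (Space n))) (ψ : 𝓢(Space n, ℂ)) :
    ∫ ξ, (𝓕 a : Lp ℂ 2 _) ξ * (𝓕 a : Lp ℂ 2 _) ξ * ψ ξ = ∫ x, autoconv a x * 𝓕 (⇑ψ) x := by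
  have hψ : Integrable (𝓕 (⇑ψ)) := by
    rw [← SchwartzMap.fourier_coe]; exact (𝓕 ψ).integrable
  refine DenseRange.induction_on
    (p := fun a : Lp ℂ 2 (volume : Measure (Space n)) =>
      ∫ ξ, (𝓕 a : Lp ℂ 2 _) ξ * (𝓕 a : Lp ℂ 2 _) ξ * ψ ξ = ∫ x, autoconv a x * 𝓕 (⇑ψ) x)
    (SchwartzMap.denseRange_toLpCLM (E := Space n) (F := ℂ) (p := 2) ENNReal.ofNat_ne_top) a
    ?_ fun f => ?_
  · exact isClosed_eq (continuous_integral_fourier_sq (ψ.memLp_top _))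
      (continuous_integral_autoconv hψ)
  · rw [SchwartzMap.toLpCLM_apply]
    have hF : (𝓕 (f.toLp 2 (volume : Measure (Space n))) : Lp ℂ 2 _)
        =ᵐ[volume] (𝓕 f : 𝓢(Space n, ℂ)) := by
      rw [SchwartzMap.toLp_fourier_eq]
      exact SchwartzMap.coeFn_toLp _ _ _
    have hconv : ∀ x, autoconv (f.toLp 2 (volume : Measure (Space n))) x
        = SchwartzMap.convolution (ContinuousLinearMap.mul ℂ ℂ) f f x := fun x => by
      rw [SchwartzMap.convolution_apply]
      refine integral_congr_ae ?_
      have h := f.coeFn_toLp 2 (volume : Measure (Space n))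
      filter_upwards [h, (measurePreserving_sub_left' x).quasiMeasurePreserving.ae h] with y h1 h2
      rw [h1, h2]
      rfl
    have hFc : ∀ ξ, (𝓕 f : 𝓢(Space n, ℂ)) ξ * (𝓕 f : 𝓢(Space n, ℂ)) ξ
        = (𝓕 (SchwartzMap.convolution (ContinuousLinearMap.mul ℂ ℂ) f f) :
          𝓢(Space n, ℂ)) ξ := fun ξ => by
      rw [SchwartzMap.fourier_convolution]
      rfl
    have e1 : ∫ ξ, (𝓕 (f.toLp 2 (volume : Measure (Space n))) : Lp ℂ 2 _) ξ
        * (𝓕 (f.toLp 2 (volume : Measure (Space n))) : Lp ℂ 2 _) ξ * ψ ξ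
        = ∫ ξ, (𝓕 (SchwartzMap.convolution (ContinuousLinearMap.mul ℂ ℂ) f f) :
          𝓢(Space n, ℂ)) ξ * ψ ξ := by
      refine integral_congr_ae ?_
      filter_upwards [hF] with ξ h
      rw [h, hFc]
    refine e1.trans ?_
    have e2 := SchwartzMap.integral_bilin_fourier_eq
      (SchwartzMap.convolution (ContinuousLinearMap.mul ℂ ℂ) f f) ψ (ContinuousLinearMap.mul ℂ ℂ)
    simp only [ContinuousLinearMap.mul_apply'] at e2
    rw [e2]
    congr with x
    rw [← hconv, SchwartzMap.fourier_coe]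

/-- If the convolution square of `a ∈ L²` is integrable, its Fourier transform is the square of the
Fourier transform of `a`. -/
lemma fourier_sq_ae_eq {a : Lp ℂ 2 (volume : Measure (Space n))} {r : Space n → ℂ}
    (hr : Integrable r) (ha : ∀ x, autoconv a x = r x) :
    ∀ᵐ ξ, (𝓕 a : Lp ℂ 2 _) ξ * (𝓕 a : Lp ℂ 2 _) ξ = 𝓕 r ξ := by
  refine ae_eq_of_integral_contDiff_smul_eq ?_ ?_ fun g hg hgs => ?_
  · exact (MemLp.integrable_mul (Lp.memLp (𝓕 a : Lp ℂ 2 _)) (Lp.memLp _)).locallyIntegrable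
  · exact (VectorFourier.fourierIntegral_continuous Real.continuous_fourierChar continuous_inner
      hr).locallyIntegrable
  · have hgs' : HasCompactSupport fun ξ => (g ξ : ℂ) := hgs.comp_left Complex.ofReal_zero
    let ψ : 𝓢(Space n, ℂ) := hgs'.toSchwartzMap (Complex.ofRealCLM.contDiff.comp hg)
    have hψ : ∀ ξ, ψ ξ = g ξ := fun _ => rfl
    have e := integral_fourier_sq_mul a ψ
    have e2 := VectorFourier.integral_fourierIntegral_smul_eq_flip (L := innerₗ (Space n))
      Real.continuous_fourierChar continuous_inner hr (ψ.integrable (μ := volume))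
    rw [flip_innerₗ] at e2
    calc ∫ ξ, g ξ • ((𝓕 a : Lp ℂ 2 _) ξ * (𝓕 a : Lp ℂ 2 _) ξ)
        = ∫ ξ, (𝓕 a : Lp ℂ 2 _) ξ * (𝓕 a : Lp ℂ 2 _) ξ * ψ ξ := by
          congr with ξ
          rw [hψ, Complex.real_smul, mul_comm]
      _ = ∫ x, r x * 𝓕 (⇑ψ) x := by rw [e]; simp only [ha]
      _ = ∫ ξ, 𝓕 r ξ * ψ ξ := e2.symm
      _ = ∫ ξ, g ξ • 𝓕 r ξ := by
          congr with ξ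
          rw [hψ, Complex.real_smul, mul_comm]

end Autoconv

section Sqrt

open scoped ENNReal

variable {n : ℕ} {ρ u : Space n → ℝ}

/-- A real convolution square root `u` of a kernel is even. Its Fourier transform squares to
`ρ̂ ≥ 0`, whence `‖u‖² = ∫ |û|² = ∫ ρ̂ = ρ(0) = ∫ u(y) u(-y) dy`, the equality case of the
Cauchy-Schwarz inequality for `u` and its reflection. -/
lemma IsKernel.even_of_sqrt (hρ : IsKernel ρ) (hu : MemLp u 2 volume) (huc : Continuous u)
    (hconv : ∀ x, ρ x = ∫ y, u y * u (x - y)) (x : Space n) : u (-x) = u x := by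
  have huC : MemLp (fun x => (u x : ℂ)) 2 volume := hu.ofReal
  set a := huC.toLp _
  have hau : a =ᵐ[volume] fun x => (u x : ℂ) := huC.coeFn_toLp
  have hac : ∀ x, autoconv a x = ρ x := fun x => by
    rw [hconv, ← integral_complex_ofReal]
    refine integral_congr_ae ?_
    filter_upwards [hau, (measurePreserving_sub_left' x).quasiMeasurePreserving.ae hau] with y h1 h2
    rw [h1, h2]
    push_cast
    rfl
  have hsq := fourier_sq_ae_eq hρ.integrable hac
  have hL2 : ∀ b : Lp ℂ 2 (volume : Measure (Space n)), ‖b‖ ^ 2 = ∫ x, ‖b x‖ ^ 2 := fun b => by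
    have h := L2.inner_def (𝕜 := ℂ) b b
    rw [inner_self_eq_norm_sq_to_K] at h
    have h2 : ∀ x, inner ℂ (b x) (b x) = ((‖b x‖ ^ 2 : ℝ) : ℂ) := fun x => by
      rw [inner_self_eq_norm_sq_to_K]
      push_cast
      rfl
    simp only [h2] at h
    rw [integral_complex_ofReal] at h
    exact Complex.ofReal_injective (by rw [← h]; push_cast; rfl)
  have h1 : ∫ x, u x ^ 2 = ρ 0 := by
    calc ∫ x, u x ^ 2 = ∫ x, ‖a x‖ ^ 2 := by
          refine integral_congr_ae ?_
          filter_upwards [hau] with x hx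
          rw [hx, Complex.norm_real, Real.norm_eq_abs, sq_abs]
      _ = ∫ ξ, ‖(𝓕 a : Lp ℂ 2 _) ξ‖ ^ 2 := by
          rw [← hL2, ← hL2, Lp.norm_fourier_eq]
      _ = ∫ ξ, spectral ρ ξ := by
          refine integral_congr_ae ?_
          filter_upwards [hsq] with ξ hξ
          rw [hρ.fourier_eq] at hξ
          rw [sq, ← norm_mul, hξ, Complex.norm_real, Real.norm_eq_abs,
            abs_of_nonneg (a := spectral ρ ξ) (hρ.fourier_nonneg ξ)]
      _ = ρ 0 := hρ.integral_spectral
  have hneg : MemLp (fun x => u (-x)) 2 volume :=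
    hu.comp_measurePreserving (Measure.measurePreserving_neg volume)
  have h2 : ∫ x, u (-x) ^ 2 = ρ 0 := by
    rw [← h1, ← integral_neg_eq_self]
    simp
  have h3 : ∫ x, u x * u (-x) = ρ 0 := by rw [hconv]; simp
  have hi := hu.integrable_mul hneg
  have h0 : ∫ x, (u (-x) - u x) ^ 2 = 0 := by
    have e : ∀ x, (u (-x) - u x) ^ 2 = u (-x) ^ 2 + u x ^ 2 - 2 * (u x * u (-x)) := fun x => by ring
    simp only [e]
    have hadd : Integrable fun x => u (-x) ^ 2 + u x ^ 2 :=
      hneg.integrable_sq.add hu.integrable_sq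
    have hmul : Integrable fun x => 2 * (u x * u (-x)) := hi.const_mul 2
    rw [integral_sub hadd hmul, integral_add hneg.integrable_sq hu.integrable_sq,
      integral_const_mul, h1, h2, h3]
    ring
  have hdiff : Integrable fun x => (u (-x) - u x) ^ 2 := (hneg.sub hu).integrable_sq
  rw [integral_eq_zero_iff_of_nonneg (fun x => sq_nonneg _) hdiff] at h0
  have hae : (fun x => u (-x)) =ᵐ[volume] u := by
    filter_upwards [h0] with x hx
    exact sub_eq_zero.1 (pow_eq_zero_iff two_ne_zero |>.1 hx)
  exact congrFun ((Continuous.ae_eq_iff_eq volume (huc.comp continuous_neg) huc).1 hae) x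

variable {Ω : Set (Space n)} [CompactSpace Ω]

/-- With a convolution square root `u` whose translates are fundamental, the particle-to-wave
seminorm is a norm: `‖μ‖_𝒟` is the `L²` norm of the continuous function `u * μ`. -/
lemma IsKernel.eq_zero_of_waveNorm_eq_zero (hρ : IsKernel ρ) (h : HasFundamentalSqrt Ω ρ)
    {μ : Meas Ω} (hμ : waveNorm ρ μ = 0) : μ = 0 := by
  obtain ⟨u, hu, huc, hu0, hconv, hdense⟩ := h
  have heven := hρ.even_of_sqrt hu huc hconv
  have hker : ∀ x y : Space n, ρ (x - y) = ∫ z, u (x - z) * u (y - z) := fun x y => by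
    rw [hconv, ← integral_sub_right_eq_self _ y]
    congr with z
    rw [← heven (z - y), neg_sub, sub_sub_sub_cancel_right, mul_comm]
  have hsq : ∀ x : Space n, Integrable fun z => u (x - z) ^ 2 := fun x =>
    (hu.comp_measurePreserving (measurePreserving_sub_left' x)).integrable_sq
  have hφ : Continuous (Function.uncurry fun (z : Space n) (x : Ω) => u ((x : Space n) - z)) :=
    huc.comp (by fun_prop)
  obtain ⟨hint, e⟩ := pairing_pairing_self_eq_integral_sq (m := (volume : Measure (Space n)))
    (φ := fun z (x : Ω) => u ((x : Space n) - z)) (C := ρ 0) hρ.continuous_sub hφ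
    (fun x => hsq x) (fun x => by simpa only [sq, sub_self] using (hker x x).ge)
    (fun x y => hker x y) μ
  have h0 : pairing (waveOp ρ μ) μ = 0 := by rw [← hρ.waveNorm_sq, hμ]; simp
  change pairing (waveOp ρ μ) μ = _ at e
  rw [e, integral_eq_zero_iff_of_nonneg (fun z => sq_nonneg _) hint] at h0
  have hcont : Continuous fun z : Space n => pairing (fun x : Ω => u ((x : Space n) - z)) μ := by
    obtain ⟨C, hC⟩ : ∃ C, ∀ z, |u z| ≤ C :=
      let v : ZeroAtInftyContinuousMap (Space n) ℝ := ⟨⟨u, huc⟩, hu0⟩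
      ⟨‖v.toBCF‖, fun z => v.toBCF.norm_coe_le_norm z⟩
    refine VectorMeasure.continuous_of_dominated (bound := fun _ => C) (fun z => ?_)
      (fun z => Eventually.of_forall fun y => hC _) (integrable_const C)
      (Eventually.of_forall fun y => ?_)
    · exact (hφ.comp (Continuous.prodMk_right z)).aestronglyMeasurable
    · exact hφ.comp (Continuous.prodMk_left y)
  have hzero : ∀ z : Space n, pairing (fun x : Ω => u ((x : Space n) - z)) μ = 0 := by
    refine fun z => congrFun ((Continuous.ae_eq_iff_eq volume hcont continuous_const).1 ?_) z
    filter_upwards [h0] with z hz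
    exact pow_eq_zero_iff two_ne_zero |>.1 hz
  refine eq_zero_of_pairing_eq_zero fun f => ?_
  have hspan : ∀ f ∈ Submodule.span ℝ
      {f : C(Ω, ℝ) | ∃ y : Ω, ∀ x : Ω, f x = u ((x : Space n) - (y : Space n))},
      pairing f μ = 0 := fun f hf => by
    induction hf using Submodule.span_induction with
    | mem f hf =>
      obtain ⟨y, hy⟩ := hf
      rw [← hzero y]
      congr 1
      exact funext hy
    | zero => exact pairing_zero_left μ
    | add f g _ _ hf hg =>
      have := pairing_add_left f.continuous g.continuous μ
      rw [hf, hg, add_zero] at this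
      exact this
    | smul c f _ hf =>
      have := pairing_smul_left f c μ
      rw [hf, mul_zero] at this
      exact this
  exact hdense.induction (P := fun f => pairing f μ = 0) hspan
    (isClosed_eq (continuous_pairing_left μ) continuous_const) f

end Sqrt

/-! ### Point insertion and weight adjustment -/

section Insertion

variable {n : ℕ} {Ω : Set (Space n)}

lemma discrete_nonneg {S : Finset Ω} {β : Ω → ℝ} (hβ : ∀ x ∈ S, 0 ≤ β x) : 0 ≤ discrete S β := by
  refine Finset.sum_nonneg fun x hx s hs => ?_
  by_cases h : x ∈ s <;> simp [h, hs, hβ x hx]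

lemma supp_discrete_subset (S : Finset Ω) (β : Ω → ℝ) {y : Ω} (hy : y ∈ supp (discrete S β)) :
    y ∈ S ∧ β y ≠ 0 := by
  by_contra hcon
  have hfin : ({x | x ∈ S ∧ β x ≠ 0} : Set Ω).Finite := S.finite_toSet.subset fun x hx => hx.1
  have hpos := (Measure.mem_support_iff_forall y).1 hy _ (hfin.isClosed.isOpen_compl.mem_nhds hcon)
  refine hpos.ne' ((VectorMeasure.variation_apply_eq_zero hfin.measurableSet.compl).2 ?_)
  intro t ht htm
  rw [discrete, _root_.sum_apply]
  refine Finset.sum_eq_zero fun x hx => ?_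
  by_cases hxt : x ∈ t
  · have : β x = 0 := by
      by_contra h0
      exact ht hxt ⟨hx, h0⟩
    simp [this]
  · simp [hxt, htm]

variable [CompactSpace Ω]

lemma pairing_discrete {f : Ω → ℝ} (hf : Continuous f) (S : Finset Ω) (β : Ω → ℝ) :
    pairing f (discrete S β) = ∑ x ∈ S, β x * f x := by
  unfold pairing discrete
  rw [VectorMeasure.integral_finsetSum_vectorMeasure fun x _ => integrable_of_continuous hf _]
  refine Finset.sum_congr rfl fun x _ => ?_
  rw [VectorMeasure.integral_dirac]
  simp

variable {ρ : Space n → ℝ} {η : Ω → ℝ} {lam ε κ : ℝ} {S : Finset Ω}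

lemma IsKernel.waveOp_discrete (hρ : IsKernel ρ) (β : Ω → ℝ) (y : Ω) :
    waveOp ρ (discrete S β) y = ∑ x ∈ S, β x * ρ ((y : Space n) - (x : Space n)) :=
  pairing_discrete (hρ.continuous_sub.comp (Continuous.prodMk_right y)) S β

/-- Where the weight is positive, the residual is controlled by the accuracy of the
finite-dimensional subproblem. -/
lemma SolvesSubproblem.abs_residual_le (hρ : IsKernel ρ) {β : Ω → ℝ}
    (h : SolvesSubproblem ρ η lam ε κ S β) {y : Ω} (hy : y ∈ S) (hβy : 0 < β y) :
    |waveOp ρ (discrete S β) y + η y + lam| ≤ κ * ε / (1 + ∑ x ∈ S, β x) := by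
  obtain ⟨-, w, hw, hres⟩ := h
  have := hres y hy
  rwa [(hw y hy).2 hβy, mul_one, ← hρ.waveOp_discrete] at this

/-- Whatever points were inserted, the returned measure satisfies the stopping bound and solves the
last finite-dimensional subproblem; only these two facts matter. -/
lemma InsertAndAdjust.conditions (hρ : IsKernel ρ) (hη : Continuous η) (hε : 0 < ε)
    (hκ : κ ∈ Set.Ioo (0 : ℝ) 1) {μ' : Meas Ω} (h : InsertAndAdjust ρ η lam ε κ S μ') :
    0 ≤ μ' ∧ (∀ y, -ε ≤ waveOp ρ μ' y + η y + lam) ∧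
      (∀ y ∈ supp μ', waveOp ρ μ' y + η y + lam ≤ ε) ∧
      pairing (fun y => waveOp ρ μ' y + η y + lam) μ' ≤ κ * ε := by
  induction h with
  | insert S β x μ' hβ hviolated hcontinue ih => exact ih
  | finish S β hβ hbound =>
    have hsum : 0 ≤ ∑ x ∈ S, β x := Finset.sum_nonneg hβ.1
    have hκε : 0 < κ * ε := mul_pos hκ.1 hε
    refine ⟨discrete_nonneg hβ.1, hbound, fun y hy => ?_, ?_⟩
    · obtain ⟨hyS, hy0⟩ := supp_discrete_subset S β hy
      refine (le_abs_self _).trans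
        ((hβ.abs_residual_le hρ hyS ((hβ.1 y hyS).lt_of_ne' hy0)).trans ?_)
      refine (div_le_self hκε.le (by linarith)).trans ?_
      nlinarith [hκ.2]
    · rw [pairing_discrete (((hρ.continuous_waveOp _).fun_add hη).fun_add continuous_const)]
      calc ∑ y ∈ S, β y * (waveOp ρ (discrete S β) y + η y + lam)
          ≤ ∑ y ∈ S, β y * (κ * ε / (1 + ∑ x ∈ S, β x)) := by
            refine Finset.sum_le_sum fun y hy => ?_
            rcases (hβ.1 y hy).eq_or_lt with h0 | h0
            · simp [← h0]
            · exact mul_le_mul_of_nonneg_left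
                ((le_abs_self _).trans (hβ.abs_residual_le hρ hy h0)) h0.le
        _ = (∑ y ∈ S, β y) * (κ * ε) / (1 + ∑ x ∈ S, β x) := by
            rw [← Finset.sum_mul]
            ring
        _ ≤ κ * ε := by
            rw [div_le_iff₀ (by linarith)]
            nlinarith

variable {α τ : ℝ} {v : C(Ω, ℝ)} {μ μ' : Meas Ω}

/-- Every step of the method solves the step problem. -/
lemma Step.stepProblem (hρ : IsKernel ρ) (hε : 0 < ε) (hκ : κ ∈ Set.Ioo (0 : ℝ) 1)
    (h : Step ρ α τ κ ε v μ μ') : StepProblem ρ α τ κ ε v μ μ' := by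
  cases h with
  | other h => exact h
  | insertAndAdjust S hS h =>
    obtain ⟨h1, h2, h3, h4⟩ := h.conditions hρ
      ((v.continuous.const_smul τ).sub (hρ.continuous_waveOp μ)) hε hκ
    have e : ∀ x, τ * (v x + α) + waveOp ρ (μ' - μ) x
        = waveOp ρ μ' x + (τ * v x - waveOp ρ μ x) + τ * α := fun x => by
      rw [hρ.waveOp_sub]
      ring
    exact ⟨h1, fun x => (e x).symm ▸ h2 x, fun x hx => (e x).symm ▸ h3 x hx, by simpa only [e]⟩

end Insertion

/-! ### The basic inequality of one step -/

section Inequality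

variable {n : ℕ} {Ω : Set (Space n)} [CompactSpace Ω] {ρ : Space n → ℝ}
  {F : Meas Ω → ℝ} {F' : Meas Ω → C(Ω, ℝ)} {L α τ κ ε : ℝ} {μ μ' ν : Meas Ω}

omit [CompactSpace Ω] in
/-- A convex function lies above its linearisations. -/
lemma add_pairing_le_of_convexOn (hconv : ConvexOn ℝ Set.univ F) (hderiv : HasPreDeriv F F')
    (μ ν : Meas Ω) : F μ + pairing (F' μ) (ν - μ) ≤ F ν := by
  refine le_of_forall_pos_le_add fun e he => ?_
  set R := radonNorm (ν - μ)
  have hR : 0 ≤ R := radonNorm_nonneg _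
  obtain ⟨δ, hδ, h⟩ := hderiv μ (e / (R + 1)) (by positivity)
  -- the difference quotient along `ν - μ` is taken at the step length `t`, small enough for the
  -- first-order expansion of `F` to be accurate to `t * e`
  set t := min 1 (δ / (2 * (R + 1)))
  have ht : 0 < t := lt_min one_pos (by positivity)
  have ht1 : t ≤ 1 := min_le_left _ _
  have htR : t * R < δ := by
    have h1 : t * (2 * (R + 1)) ≤ δ := (le_div_iff₀ (by positivity)).1 (min_le_right _ _)
    nlinarith
  have e1 : μ + t • (ν - μ) - μ = t • (ν - μ) := add_sub_cancel_left _ _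
  have hd := h (μ + t • (ν - μ)) (by rw [e1, radonNorm_smul, abs_of_pos ht]; exact htR)
  rw [e1, radonNorm_smul, pairing_smul_right, abs_of_pos ht] at hd
  have hc := hconv.2 (Set.mem_univ μ) (Set.mem_univ ν) (sub_nonneg.2 ht1) ht.le
    (sub_add_cancel 1 t)
  have e2 : (1 - t) • μ + t • ν = μ + t • (ν - μ) := by
    ext s _
    simp only [_root_.add_apply, _root_.smul_apply, _root_.sub_apply, smul_eq_mul]
    ring
  rw [e2, smul_eq_mul, smul_eq_mul] at hc
  have hd' := (abs_le.1 hd).1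
  have hle : e / (R + 1) * (t * R) ≤ t * e := by
    rw [div_mul_eq_mul_div, div_le_iff₀ (by positivity)]
    nlinarith [mul_pos ht he]
  change -(e / (R + 1) * (t * R)) ≤ _ at hd'
  have : t * (F μ + pairing (F' μ) (ν - μ)) ≤ t * (F ν + e) := by nlinarith
  exact le_of_mul_le_mul_left this ht

/-- The finite value `F(μ) + α‖μ‖` of the objective at a non-negative measure. -/
noncomputable def value (F : Meas Ω → ℝ) (α : ℝ) (μ : Meas Ω) : ℝ := F μ + α * radonNorm μ

/-- One step of the method decreases the objective and the distance to any `ν ≥ 0`, up to the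
tolerance. -/
lemma StepProblem.value_sub_le (hρ : IsKernel ρ) (hconv : ConvexOn ℝ Set.univ F)
    (hderiv : HasPreDeriv F F') (hsmooth : IsSmooth ρ L F F') (hτ : 0 < τ)
    (h : StepProblem ρ α τ κ ε (F' μ) μ μ') (hν : 0 ≤ ν) :
    τ * (value F α μ' - value F α ν) + waveNorm ρ (ν - μ') ^ 2 / 2
        + (1 - τ * L) / 2 * waveNorm ρ (μ' - μ) ^ 2
      ≤ waveNorm ρ (ν - μ) ^ 2 / 2 + ε * (radonNorm ν + κ) := by
  set D := waveOp ρ (μ' - μ)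
  have hD : Continuous D := hρ.continuous_waveOp _
  have hv : Continuous fun x => τ * (F' μ x + α) :=
    ((F' μ).continuous.add continuous_const).const_smul τ
  have hW : ∀ σ : Meas Ω, 0 ≤ σ → pairing (fun x => τ * (F' μ x + α) + D x) σ
      = τ * (pairing (F' μ) σ + α * radonNorm σ) + pairing D σ := fun σ hσ => by
    have hconst : pairing (fun _ => α) σ = α * radonNorm σ := by
      rw [radonNorm_eq_pairing_one hσ, ← pairing_smul_left]
      simp
    rw [pairing_add_left hv hD, pairing_smul_left,
      pairing_add_left (F' μ).continuous continuous_const, hconst]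
  have hlow : -ε * radonNorm ν ≤ pairing (fun x => τ * (F' μ x + α) + D x) ν := by
    have := pairing_mono continuous_const (hv.add hD) h.lower hν
    refine le_trans (le_of_eq ?_) this
    rw [radonNorm_eq_pairing_one hν, ← pairing_smul_left]
    simp
  have hup := h.bounded
  rw [hW ν hν] at hlow
  rw [hW μ' h.nonneg] at hup
  have h3 := hρ.pairing_waveOp_sub_sub μ μ' ν
  rw [pairing_sub_right hD] at h3
  have hF := add_pairing_le_of_convexOn hconv hderiv μ ν
  have hS := hsmooth μ μ'
  rw [pairing_sub_right (F' μ).continuous] at hF hS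
  unfold value
  have h5 := mul_le_mul_of_nonneg_left hF hτ.le
  have h6 := mul_le_mul_of_nonneg_left hS hτ.le
  nlinarith

end Inequality

/-! ### Almost decreasing sequences -/

section Sequences

lemma exists_tendsto_of_le_add_summable {a d : ℕ → ℝ} {C : ℝ} (hC : ∀ k, C ≤ a k)
    (hd : Summable d) (hd0 : ∀ k, 0 ≤ d k) (h : ∀ k, a (k + 1) ≤ a k + d k) :
    ∃ l, Tendsto a atTop (𝓝 l) := by
  have hanti : Antitone fun k => a k - ∑ i ∈ Finset.range k, d i :=
    antitone_nat_of_succ_le fun k => by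
      rw [Finset.sum_range_succ]
      linarith [h k]
  have hbdd : BddBelow (Set.range fun k => a k - ∑ i ∈ Finset.range k, d i) := by
    refine ⟨C - ∑' i, d i, ?_⟩
    rintro _ ⟨k, rfl⟩
    have := hd.sum_le_tsum (Finset.range k) fun i _ => hd0 i
    dsimp only
    linarith [hC k]
  have := (tendsto_atTop_ciInf hanti hbdd).add hd.hasSum.tendsto_sum_nat
  simp only [sub_add_cancel] at this
  exact ⟨_, this⟩

/-- A discrete Grönwall inequality. -/
lemma exists_le_of_le_one_add_mul {b d : ℕ → ℝ} (hb : ∀ k, 0 ≤ b k) (hd : Summable d)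
    (hd0 : ∀ k, 0 ≤ d k) (h : ∀ k, b (k + 1) ≤ (1 + d k) * b k) : ∃ C, ∀ k, b k ≤ C := by
  refine ⟨b 0 * Real.exp (∑' i, d i), fun k => ?_⟩
  have key : b k ≤ b 0 * Real.exp (∑ i ∈ Finset.range k, d i) := by
    induction k with
    | zero => simp
    | succ k ih =>
      rw [Finset.sum_range_succ, Real.exp_add]
      calc b (k + 1) ≤ (1 + d k) * b k := h k
        _ ≤ Real.exp (d k) * (b 0 * Real.exp (∑ i ∈ Finset.range k, d i)) :=
            mul_le_mul (by linarith [Real.add_one_le_exp (d k)]) ih (hb k) (Real.exp_pos _).le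
        _ = _ := by ring
  refine key.trans (mul_le_mul_of_nonneg_left (Real.exp_le_exp.2 ?_) (hb 0))
  exact hd.sum_le_tsum _ fun i _ => hd0 i

/-- If the excesses `a k - e` are bounded by the decrements of a non-negative sequence, up to a
summable error, then the limit of `a` is at most `e`. -/
lemma le_of_tendsto_of_telescoping {a D d : ℕ → ℝ} {τ e l : ℝ} (hτ : 0 < τ)
    (ha : Tendsto a atTop (𝓝 l)) (hD : ∀ k, 0 ≤ D k) (hd : Summable d) (hd0 : ∀ k, 0 ≤ d k)
    (h : ∀ k, τ * (a k - e) ≤ D k - D (k + 1) + d k) : l ≤ e := by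
  have hsum : ∀ N, ∑ k ∈ Finset.range N, τ * (a k - e) ≤ D 0 + ∑' k, d k := fun N => by
    calc ∑ k ∈ Finset.range N, τ * (a k - e)
        ≤ ∑ k ∈ Finset.range N, (D k - D (k + 1) + d k) := Finset.sum_le_sum fun k _ => h k
      _ = D 0 - D N + ∑ k ∈ Finset.range N, d k := by
          rw [Finset.sum_add_distrib, Finset.sum_range_sub']
      _ ≤ D 0 + ∑' k, d k := by
          have := hd.sum_le_tsum (Finset.range N) fun i _ => hd0 i
          linarith [hD N]
  have hces := ((ha.sub_const e).const_mul τ).cesaro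
  have hzero : Tendsto (fun N : ℕ => (N : ℝ)⁻¹ * (D 0 + ∑' k, d k)) atTop (𝓝 0) := by
    simpa using (tendsto_inv_atTop_nhds_zero_nat (𝕜 := ℝ)).mul_const (D 0 + ∑' k, d k)
  have := le_of_tendsto_of_tendsto' hces hzero fun N =>
    mul_le_mul_of_nonneg_left (hsum N) (inv_nonneg.2 N.cast_nonneg)
  nlinarith

end Sequences

/-! ### Minimisers of the objective -/

section Objective

variable {n : ℕ} {Ω : Set (Space n)} [CompactSpace Ω] {ρ : Space n → ℝ}
  {F : Meas Ω → ℝ} {F' : Meas Ω → C(Ω, ℝ)} {α : ℝ}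

omit [CompactSpace Ω] in
lemma objective_of_nonneg {ν : Meas Ω} (h : 0 ≤ ν) : objective F α ν = (value F α ν : EReal) := by
  rw [objective, regulariser, if_pos h, ← EReal.coe_add]
  rfl

omit [CompactSpace Ω] in
lemma objective_of_not_nonneg {ν : Meas Ω} (h : ¬ 0 ≤ ν) : objective F α ν = ⊤ := by
  rw [objective, regulariser, if_neg h, EReal.coe_add_top]

omit [CompactSpace Ω] in
lemma zero_mem_preSubdifferential_iff {ν : Meas Ω} :
    (0 : C(Ω, ℝ)) ∈ preSubdifferential (objective F α) ν ↔
      0 ≤ ν ∧ ∀ σ : Meas Ω, 0 ≤ σ → value F α ν ≤ value F α σ := by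
  have hz : ∀ σ : Meas Ω, pairing (0 : C(Ω, ℝ)) σ = 0 := fun σ => pairing_zero_left σ
  simp only [preSubdifferential, Set.mem_ofPred_eq, hz, EReal.coe_zero, add_zero]
  constructor
  · intro h
    have hν : 0 ≤ ν := by
      by_contra hcon
      have := h 0
      rw [objective_of_not_nonneg hcon, objective_of_nonneg le_rfl] at this
      exact absurd this (not_le.2 (EReal.coe_lt_top _))
    refine ⟨hν, fun σ hσ => ?_⟩
    have := h σ
    rw [objective_of_nonneg hν, objective_of_nonneg hσ] at this
    exact_mod_cast this
  · rintro ⟨hν, h⟩ σ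
    by_cases hσ : 0 ≤ σ
    · rw [objective_of_nonneg hν, objective_of_nonneg hσ]
      exact_mod_cast h σ hσ
    · rw [objective_of_not_nonneg hσ]
      exact le_top

omit [CompactSpace Ω] in
/-- The lower bound `φ` makes the objective grow at least linearly in the Radon norm. -/
lemma exists_linear_lower_bound {φ : ℝ → EReal}
    (hφ_bdd : ∃ c : ℝ, ∀ t, 0 ≤ t → (c : EReal) ≤ φ t)
    (hφ_lim : ∃ l : EReal, 0 < l ∧ Tendsto (fun t : ℝ => φ t / (t : EReal)) atTop (𝓝 l))
    (hφ : ∀ ν : Meas Ω, φ (radonNorm ν) ≤ objective F α ν) :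
    ∃ c > 0, ∃ C : ℝ, ∀ ν : Meas Ω, 0 ≤ ν → c * radonNorm ν ≤ value F α ν + C := by
  obtain ⟨b, hb⟩ := hφ_bdd
  obtain ⟨l, hl, hlim⟩ := hφ_lim
  obtain ⟨c, hc0, hcl⟩ := EReal.lt_iff_exists_real_btwn.1 hl
  have hc : 0 < c := by exact_mod_cast hc0
  obtain ⟨T, hT⟩ := eventually_atTop.1 (hlim.eventually_const_lt hcl)
  refine ⟨c, hc, c * max T 1 + |b|, fun ν hν => ?_⟩
  have h := hφ ν
  rw [objective_of_nonneg hν] at h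
  have hr := radonNorm_nonneg ν
  rcases le_total (max T 1) (radonNorm ν) with hle | hle
  · have h1 := hT _ ((le_max_left _ _).trans hle)
    have hpos : 0 < radonNorm ν := one_pos.trans_le ((le_max_right _ _).trans hle)
    have h2 : ((c * radonNorm ν : ℝ) : EReal) ≤ φ (radonNorm ν) := by
      rw [EReal.coe_mul]
      exact (EReal.le_div_iff_mul_le (by exact_mod_cast hpos) (EReal.coe_ne_top _)).1 h1.le
    have h3 : c * radonNorm ν ≤ value F α ν := by exact_mod_cast h2.trans h
    have : 0 ≤ c * max T 1 := by positivity
    linarith [abs_nonneg b]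
  · have h3 : b ≤ value F α ν := by exact_mod_cast (hb _ hr).trans h
    have : c * radonNorm ν ≤ c * max T 1 := mul_le_mul_of_nonneg_left hle hc.le
    linarith [neg_abs_le b]

/-- The objective is weakly-* lower semicontinuous along non-negative measures: `F` lies above its
linearisation at the limit, and the Radon norm of a non-negative measure is its pairing with `1`. -/
lemma value_le_of_weakStarTendsto (hconv : ConvexOn ℝ Set.univ F) (hderiv : HasPreDeriv F F')
    {σ : ℕ → Meas Ω} {ν : Meas Ω} {l : ℝ} (hσ : ∀ᶠ k in atTop, 0 ≤ σ k) (hν : 0 ≤ ν)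
    (h : WeakStarTendsto σ ν) (hl : Tendsto (fun k => value F α (σ k)) atTop (𝓝 l)) :
    value F α ν ≤ l := by
  have h1 : Tendsto (fun k => F ν + (pairing (F' ν) (σ k) - pairing (F' ν) ν)
      + α * pairing (ContinuousMap.const Ω (1 : ℝ)) (σ k)) atTop
      (𝓝 (F ν + (pairing (F' ν) ν - pairing (F' ν) ν)
        + α * pairing (ContinuousMap.const Ω (1 : ℝ)) ν)) :=
    (((h (F' ν)).sub_const _).const_add _).add ((h (ContinuousMap.const Ω (1 : ℝ))).const_mul α)
  rw [sub_self, add_zero] at h1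
  have e : ∀ τ : Meas Ω, 0 ≤ τ → pairing (ContinuousMap.const Ω (1 : ℝ)) τ = radonNorm τ :=
    fun τ hτ => (radonNorm_eq_pairing_one hτ).symm
  rw [e ν hν] at h1
  refine le_of_tendsto_of_tendsto h1 hl ?_
  filter_upwards [hσ] with k hk
  rw [e _ hk, ← pairing_sub_right (F' ν).continuous]
  exact add_le_add_left (add_pairing_le_of_convexOn hconv hderiv ν (σ k)) _

end Objective

/-! ### Convergence of the iterates -/

section Convergence

variable {n : ℕ} {Ω : Set (Space n)} [CompactSpace Ω] {ρ : Space n → ℝ}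
  {F : Meas Ω → ℝ} {F' : Meas Ω → C(Ω, ℝ)} {L α τ κ c C : ℝ} {ε : ℕ → ℝ} {μ : ℕ → Meas Ω}

/-- The iterates from `μ¹` on are bounded. (The initial `μ⁰` need not be non-negative, and the
objective may be infinite at it.) -/
lemma exists_radonNorm_le (hρ : IsKernel ρ) (hconv : ConvexOn ℝ Set.univ F)
    (hderiv : HasPreDeriv F F') (hsmooth : IsSmooth ρ L F F') (hτ : 0 < τ) (hτL : τ * L < 1)
    (hκ : 0 < κ) (hε : ∀ k, 0 < ε (k + 1)) (hεs : Summable fun k => ε (k + 1)) (hc : 0 < c)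
    (hcoer : ∀ ν : Meas Ω, 0 ≤ ν → c * radonNorm ν ≤ value F α ν + C)
    (hstep : ∀ k, StepProblem ρ α τ κ (ε (k + 1)) (F' (μ k)) (μ k) (μ (k + 1))) :
    ∃ R, ∀ k, radonNorm (μ (k + 1)) ≤ R := by
  have hnn : ∀ k, 0 ≤ μ (k + 1) := fun k => (hstep k).nonneg
  have hεs' : Summable fun k => ε (k + 1 + 1) := (summable_nat_add_iff 1).2 hεs
  have hb : ∀ k, radonNorm (μ (k + 1)) ≤ (value F α (μ (k + 1)) + C) / c := fun k => by
    rw [le_div_iff₀ hc, mul_comm]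
    exact hcoer _ (hnn k)
  -- with `b k` the bound `hb` plus `κ`, the error `ε (k + 2) * (‖μ (k + 1)‖ + κ)` of a step is at
  -- most `ε (k + 2) * b k`, so that `b` grows at most by the factors `1 + ε (k + 2) / (τ * c)`
  obtain ⟨B, hB⟩ := exists_le_of_le_one_add_mul
    (b := fun k => (value F α (μ (k + 1)) + C) / c + κ) (d := fun k => ε (k + 1 + 1) / (τ * c))
    (fun k => by
      have := (radonNorm_nonneg (μ (k + 1))).trans (hb k)
      positivity)
    (hεs'.div_const _) (fun k => by have := hε (k + 1); positivity) (fun k => by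
      have h := (hstep (k + 1)).value_sub_le hρ hconv hderiv hsmooth hτ (hnn k)
      have h0 : waveNorm ρ (μ (k + 1) - μ (k + 1)) ^ 2 = 0 := by
        simp [waveNorm_zero]
      rw [h0] at h
      have h1 := sq_nonneg (waveNorm ρ (μ (k + 1) - μ (k + 1 + 1)))
      have h2 : 0 ≤ (1 - τ * L) / 2 * waveNorm ρ (μ (k + 1 + 1) - μ (k + 1)) ^ 2 :=
        mul_nonneg (by linarith) (sq_nonneg _)
      have h3 : τ * (value F α (μ (k + 1 + 1)) - value F α (μ (k + 1)))
          ≤ ε (k + 1 + 1) * (radonNorm (μ (k + 1)) + κ) := by linarith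
      have h4 : ε (k + 1 + 1) * (radonNorm (μ (k + 1)) + κ)
          ≤ ε (k + 1 + 1) * ((value F α (μ (k + 1)) + C) / c + κ) :=
        mul_le_mul_of_nonneg_left (by linarith [hb k]) (hε (k + 1)).le
      have h5 : (value F α (μ (k + 1 + 1)) - value F α (μ (k + 1))) / c
          ≤ ε (k + 1 + 1) / (τ * c) * ((value F α (μ (k + 1)) + C) / c + κ) := by
        rw [div_mul_eq_mul_div, div_le_div_iff₀ hc (by positivity)]
        nlinarith [h3.trans h4]
      have h6 : (value F α (μ (k + 1 + 1)) + C) / c = (value F α (μ (k + 1)) + C) / c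
          + (value F α (μ (k + 1 + 1)) - value F α (μ (k + 1))) / c := by ring
      rw [h6]
      linarith)
  exact ⟨B, fun k => (hb k).trans (by linarith [hB k])⟩

/-- The values of the objective converge, and their limit is a lower bound of the objective: the
step inequality, summed over the steps, bounds the Cesàro means of the values. -/
lemma exists_tendsto_value (hρ : IsKernel ρ) (hconv : ConvexOn ℝ Set.univ F)
    (hderiv : HasPreDeriv F F') (hsmooth : IsSmooth ρ L F F') (hτ : 0 < τ) (hτL : τ * L < 1)
    (hκ : 0 < κ) (hε : ∀ k, 0 < ε (k + 1)) (hεs : Summable fun k => ε (k + 1)) (hc : 0 < c)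
    (hcoer : ∀ ν : Meas Ω, 0 ≤ ν → c * radonNorm ν ≤ value F α ν + C)
    (hstep : ∀ k, StepProblem ρ α τ κ (ε (k + 1)) (F' (μ k)) (μ k) (μ (k + 1))) :
    ∃ l, Tendsto (fun k => value F α (μ k)) atTop (𝓝 l) ∧
      ∀ ν : Meas Ω, 0 ≤ ν → l ≤ value F α ν := by
  have hnn : ∀ k, 0 ≤ μ (k + 1) := fun k => (hstep k).nonneg
  have hεs' : Summable fun k => ε (k + 1 + 1) := (summable_nat_add_iff 1).2 hεs
  obtain ⟨R, hR⟩ := exists_radonNorm_le hρ hconv hderiv hsmooth hτ hτL hκ hε hεs hc hcoer hstep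
  have hR0 : 0 ≤ R := (radonNorm_nonneg _).trans (hR 0)
  have hbase : ∀ k (ν : Meas Ω), 0 ≤ ν → τ * (value F α (μ (k + 1)) - value F α ν)
      ≤ waveNorm ρ (ν - μ k) ^ 2 / 2 - waveNorm ρ (ν - μ (k + 1)) ^ 2 / 2
        + ε (k + 1) * (radonNorm ν + κ) := fun k ν hν => by
    have h := (hstep k).value_sub_le hρ hconv hderiv hsmooth hτ hν
    have h2 : 0 ≤ (1 - τ * L) / 2 * waveNorm ρ (μ (k + 1) - μ k) ^ 2 :=
      mul_nonneg (by linarith) (sq_nonneg _)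
    linarith
  obtain ⟨l, hl⟩ := exists_tendsto_of_le_add_summable (a := fun k => value F α (μ (k + 1)))
    (C := -C) (d := fun k => ε (k + 1 + 1) * ((R + κ) / τ))
    (fun k => by
      have := mul_nonneg hc.le (radonNorm_nonneg (μ (k + 1)))
      linarith [hcoer _ (hnn k)])
    (hεs'.mul_right _) (fun k => by have := hε (k + 1); positivity) (fun k => by
      have h := hbase (k + 1) _ (hnn k)
      have h0 : waveNorm ρ (μ (k + 1) - μ (k + 1)) ^ 2 = 0 := by
        simp [waveNorm_zero]
      rw [h0] at h
      have h1 := sq_nonneg (waveNorm ρ (μ (k + 1) - μ (k + 1 + 1)))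
      have h4 : ε (k + 1 + 1) * (radonNorm (μ (k + 1)) + κ) ≤ ε (k + 1 + 1) * (R + κ) :=
        mul_le_mul_of_nonneg_left (by linarith [hR k]) (hε (k + 1)).le
      have h5 : τ * (ε (k + 1 + 1) * ((R + κ) / τ)) = ε (k + 1 + 1) * (R + κ) := by
        field_simp
      have h6 : τ * value F α (μ (k + 1 + 1))
          ≤ τ * (value F α (μ (k + 1)) + ε (k + 1 + 1) * ((R + κ) / τ)) := by
        rw [mul_add, h5]
        linarith
      exact le_of_mul_le_mul_left h6 hτ)
  refine ⟨l, (tendsto_add_atTop_iff_nat 1).1 hl, fun ν hν => ?_⟩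
  exact le_of_tendsto_of_telescoping hτ hl (fun k => by positivity)
    (hεs.mul_right (radonNorm ν + κ))
    (fun k => mul_nonneg (hε k).le (add_nonneg (radonNorm_nonneg ν) hκ.le))
    (fun k => hbase k ν hν)

/-- The iterates are quasi-Fejér monotone: their distances to a minimiser converge. -/
lemma exists_tendsto_waveNorm_sub (hρ : IsKernel ρ) (hconv : ConvexOn ℝ Set.univ F)
    (hderiv : HasPreDeriv F F') (hsmooth : IsSmooth ρ L F F') (hτ : 0 < τ) (hτL : τ * L < 1)
    (hκ : 0 < κ) (hε : ∀ k, 0 < ε (k + 1)) (hεs : Summable fun k => ε (k + 1))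
    (hstep : ∀ k, StepProblem ρ α τ κ (ε (k + 1)) (F' (μ k)) (μ k) (μ (k + 1)))
    {ν : Meas Ω} (hν : 0 ≤ ν) (hmin : ∀ σ : Meas Ω, 0 ≤ σ → value F α ν ≤ value F α σ) :
    ∃ l, Tendsto (fun k => waveNorm ρ (ν - μ k) ^ 2 / 2) atTop (𝓝 l) :=
  exists_tendsto_of_le_add_summable (C := 0) (d := fun k => ε (k + 1) * (radonNorm ν + κ))
    (fun k => by positivity) (hεs.mul_right _)
    (fun k => mul_nonneg (hε k).le (add_nonneg (radonNorm_nonneg ν) hκ.le)) (fun k => by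
      have h := (hstep k).value_sub_le hρ hconv hderiv hsmooth hτ hν
      have h2 : 0 ≤ (1 - τ * L) / 2 * waveNorm ρ (μ (k + 1) - μ k) ^ 2 :=
        mul_nonneg (by linarith) (sq_nonneg _)
      have h3 : 0 ≤ τ * (value F α (μ (k + 1)) - value F α ν) :=
        mul_nonneg hτ.le (sub_nonneg.2 (hmin _ (hstep k).nonneg))
      linarith)

/-- Opial's argument: if the distances of a sequence to each of two of its weak-* limit points
converge, then the limit points have distance zero. The difference of the squared distances is, up
to a constant, the pairing of the sequence with the continuous function `𝒟(ν₁ - ν₂)`, whose limits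
along the two subsequences have to coincide. -/
lemma waveNorm_sub_eq_zero_of_tendsto (hρ : IsKernel ρ) {ν₁ ν₂ : Meas Ω} {l₁ l₂ : ℝ}
    (h₁ : IsWeakStarLimitPoint μ ν₁) (h₂ : IsWeakStarLimitPoint μ ν₂)
    (hl₁ : Tendsto (fun k => waveNorm ρ (ν₁ - μ k) ^ 2 / 2) atTop (𝓝 l₁))
    (hl₂ : Tendsto (fun k => waveNorm ρ (ν₂ - μ k) ^ 2 / 2) atTop (𝓝 l₂)) :
    waveNorm ρ (ν₁ - ν₂) = 0 := by
  obtain ⟨s₁, hs₁, ht₁⟩ := h₁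
  obtain ⟨s₂, hs₂, ht₂⟩ := h₂
  have hexp : ∀ ν σ : Meas Ω, waveNorm ρ (ν - σ) ^ 2
      = pairing (waveOp ρ ν) ν - 2 * pairing (waveOp ρ ν) σ + pairing (waveOp ρ σ) σ :=
    fun ν σ => by
      rw [hρ.waveNorm_sq, hρ.pairing_waveOp_sub_left, pairing_sub_right (hρ.continuous_waveOp _),
        pairing_sub_right (hρ.continuous_waveOp _), hρ.pairing_waveOp_comm σ ν]
      ring
  have hlim : ∃ l, Tendsto (fun k => pairing (waveOp ρ (ν₁ - ν₂)) (μ k)) atTop (𝓝 l) := by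
    refine ⟨_, ((hl₂.sub hl₁).add_const
      ((pairing (waveOp ρ ν₁) ν₁ - pairing (waveOp ρ ν₂) ν₂) / 2)).congr fun k => ?_⟩
    rw [hexp, hexp, hρ.pairing_waveOp_sub_left]
    ring
  obtain ⟨l, hl⟩ := hlim
  let f : C(Ω, ℝ) := ⟨waveOp ρ (ν₁ - ν₂), hρ.continuous_waveOp _⟩
  have e₁ : pairing f ν₁ = l := tendsto_nhds_unique (ht₁ f) (hl.comp hs₁.tendsto_atTop)
  have e₂ : pairing f ν₂ = l := tendsto_nhds_unique (ht₂ f) (hl.comp hs₂.tendsto_atTop)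
  have hz : pairing (waveOp ρ (ν₁ - ν₂)) (ν₁ - ν₂) = 0 := by
    rw [pairing_sub_right (hρ.continuous_waveOp _)]
    exact sub_eq_zero.2 (e₁.trans e₂.symm)
  rw [waveNorm, hz, Real.sqrt_zero]

/-- Every subsequence of the iterates has a subsequence that converges weakly-* to a minimiser. -/
lemma exists_subseq_optimal (hρ : IsKernel ρ) (hconv : ConvexOn ℝ Set.univ F)
    (hderiv : HasPreDeriv F F') (hsmooth : IsSmooth ρ L F F') (hτ : 0 < τ) (hτL : τ * L < 1)
    (hκ : 0 < κ) (hε : ∀ k, 0 < ε (k + 1)) (hεs : Summable fun k => ε (k + 1)) (hc : 0 < c)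
    (hcoer : ∀ ν : Meas Ω, 0 ≤ ν → c * radonNorm ν ≤ value F α ν + C)
    (hstep : ∀ k, StepProblem ρ α τ κ (ε (k + 1)) (F' (μ k)) (μ k) (μ (k + 1)))
    {s : ℕ → ℕ} (hs : StrictMono s) :
    ∃ ν : Meas Ω, IsOptimalLimitPoint F α μ ν ∧
      ∃ t : ℕ → ℕ, WeakStarTendsto (fun j => μ (s (t j))) ν := by
  obtain ⟨R, hR⟩ := exists_radonNorm_le hρ hconv hderiv hsmooth hτ hτL hκ hε hεs hc hcoer hstep
  obtain ⟨l, hl, hmin⟩ :=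
    exists_tendsto_value hρ hconv hderiv hsmooth hτ hτL hκ hε hεs hc hcoer hstep
  have hpos : ∀ j, ∃ k, s (j + 1) = k + 1 := fun j =>
    Nat.exists_eq_succ_of_ne_zero (Nat.ne_of_gt ((Nat.succ_pos j).trans_le (hs.id_le (j + 1))))
  have hnn : ∀ j, 0 ≤ μ (s (j + 1)) := fun j => by
    obtain ⟨k, hk⟩ := hpos j
    rw [hk]
    exact (hstep k).nonneg
  obtain ⟨ν, hν, t, ht, hlim⟩ := exists_subseq_weakStarTendsto (μ := fun j => μ (s (j + 1))) hnn
    fun j => by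
      obtain ⟨k, hk⟩ := hpos j
      rw [hk]
      exact hR k
  have hmono : StrictMono fun j => s (t j + 1) := hs.comp (ht.add_const 1)
  have hval := value_le_of_weakStarTendsto hconv hderiv
    (Eventually.of_forall fun j => hnn (t j)) hν hlim (hl.comp hmono.tendsto_atTop)
  exact ⟨ν, ⟨⟨_, hmono, hlim⟩, zero_mem_preSubdifferential_iff.2
    ⟨hν, fun σ hσ => hval.trans (hmin σ hσ)⟩⟩, fun j => t j + 1, hlim⟩

end Convergence

end MuFB

theorem mainTheorem4 {n : ℕ} (Ω : Set (MuFB.Space n)) [CompactSpace Ω]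
    -- the kernel of the particle-to-wave operator
    (ρ : MuFB.Space n → ℝ) (hρ : MuFB.IsKernel ρ)
    -- the data term, its pre-derivative, and the smoothness factor
    (F : MuFB.Meas Ω → ℝ) (F' : MuFB.Meas Ω → C(Ω, ℝ)) (L : ℝ)
    (hF_convex : ConvexOn ℝ Set.univ F)
    (hF_deriv : MuFB.HasPreDeriv F F')
    (hF_smooth : MuFB.IsSmooth ρ L F F')
    (hF_cont : MuFB.WaveContinuous ρ F')
    -- the parameters of the method
    (α τ κ : ℝ) (hα : 0 < α) (hτ : 0 < τ) (hτL : τ * L < 1) (hκ : κ ∈ Set.Ioo (0 : ℝ) 1)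
    (ε : ℕ → ℝ) (hε_pos : ∀ k, 0 < ε (k + 1)) (hε_sum : Summable fun k => ε (k + 1))
    -- the coercive lower bound
    (φ : ℝ → EReal) (hφ_bdd : ∃ c : ℝ, ∀ t, 0 ≤ t → (c : EReal) ≤ φ t)
    (hφ_lim : ∃ l : EReal, 0 < l ∧ Tendsto (fun t : ℝ => φ t / (t : EReal)) atTop (𝓝 l))
    (hφ : ∀ ν : MuFB.Meas Ω, φ (MuFB.radonNorm ν) ≤ MuFB.objective F α ν)
    -- the iterates
    (μ : ℕ → MuFB.Meas Ω) (hμ : MuFB.IsGenerated ρ F' α τ κ ε μ) :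
    (∃ ν, MuFB.IsOptimalLimitPoint F α μ ν) ∧
    (∀ ν₁ ν₂, MuFB.IsOptimalLimitPoint F α μ ν₁ → MuFB.IsOptimalLimitPoint F α μ ν₂ →
      MuFB.waveNorm ρ (ν₁ - ν₂) = 0) ∧
    (∀ ν, MuFB.IsOptimalLimitPoint F α μ ν →
      (∀ ν', MuFB.IsOptimalLimitPoint F α μ ν' → ν' = ν) → MuFB.WeakStarTendsto μ ν) ∧
    (((∀ ν : MuFB.Meas Ω, MuFB.waveNorm ρ ν = 0 → ν = 0) ∨ MuFB.HasFundamentalSqrt Ω ρ) →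
      ∃ ν, MuFB.IsOptimalLimitPoint F α μ ν ∧
        (∀ ν', MuFB.IsOptimalLimitPoint F α μ ν' → ν' = ν) ∧ MuFB.WeakStarTendsto μ ν) := by
  obtain ⟨c, hc, C, hcoer⟩ := MuFB.exists_linear_lower_bound hφ_bdd hφ_lim hφ
  have hstep : ∀ k, MuFB.StepProblem ρ α τ κ (ε (k + 1)) (F' (μ k)) (μ k) (μ (k + 1)) :=
    fun k => (hμ.step k).stepProblem hρ (hε_pos k) hκ
  have hsub : ∀ s : ℕ → ℕ, StrictMono s → ∃ ν, MuFB.IsOptimalLimitPoint F α μ ν ∧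
      ∃ t : ℕ → ℕ, MuFB.WeakStarTendsto (fun j => μ (s (t j))) ν := fun s hs =>
    MuFB.exists_subseq_optimal hρ hF_convex hF_deriv hF_smooth hτ hτL hκ.1 hε_pos hε_sum hc hcoer
      hstep hs
  have hex : ∃ ν, MuFB.IsOptimalLimitPoint F α μ ν :=
    (hsub id strictMono_id).imp fun _ h => h.1
  have hdist : ∀ ν₁ ν₂, MuFB.IsOptimalLimitPoint F α μ ν₁ → MuFB.IsOptimalLimitPoint F α μ ν₂ →
      MuFB.waveNorm ρ (ν₁ - ν₂) = 0 := fun ν₁ ν₂ h₁ h₂ => by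
    obtain ⟨hν₁, hmin₁⟩ := MuFB.zero_mem_preSubdifferential_iff.1 h₁.2
    obtain ⟨hν₂, hmin₂⟩ := MuFB.zero_mem_preSubdifferential_iff.1 h₂.2
    obtain ⟨l₁, hl₁⟩ := MuFB.exists_tendsto_waveNorm_sub hρ hF_convex hF_deriv hF_smooth hτ hτL
      hκ.1 hε_pos hε_sum hstep hν₁ hmin₁
    obtain ⟨l₂, hl₂⟩ := MuFB.exists_tendsto_waveNorm_sub hρ hF_convex hF_deriv hF_smooth hτ hτL
      hκ.1 hε_pos hε_sum hstep hν₂ hmin₂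
    exact MuFB.waveNorm_sub_eq_zero_of_tendsto hρ h₁.1 h₂.1 hl₁ hl₂
  have hwhole : ∀ ν, (∀ ν', MuFB.IsOptimalLimitPoint F α μ ν' → ν' = ν) →
      MuFB.WeakStarTendsto μ ν := fun ν huniq f => by
    refine tendsto_of_subseq_tendsto fun s hs => ?_
    obtain ⟨r, -, hr⟩ := strictMono_subseq_of_tendsto_atTop hs
    obtain ⟨ν', hν', t, ht⟩ := hsub _ hr
    rw [huniq ν' hν'] at ht
    exact ⟨r ∘ t, ht f⟩
  refine ⟨hex, hdist, fun ν _ huniq => hwhole ν huniq, fun h => ?_⟩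
  have hnorm : ∀ ν : MuFB.Meas Ω, MuFB.waveNorm ρ ν = 0 → ν = 0 := fun ν hν =>
    h.elim (fun h => h ν hν) fun h => hρ.eq_zero_of_waveNorm_eq_zero h hν
  obtain ⟨ν, hν⟩ := hex
  have huniq : ∀ ν', MuFB.IsOptimalLimitPoint F α μ ν' → ν' = ν := fun ν' hν' =>
    sub_eq_zero.1 (hnorm _ (hdist ν' ν hν' hν))
  exact ⟨ν, hν, huniq, hwhole ν huniq⟩
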